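/- Let $R_A=A[x_{11},x_{12},x_{21},x_{22}]/(x_{11}x_{22}-x_{12}x_{21}-1)$ be the coordinate Hopf algebra of $\operatorname{SL}_{2,A}$ over a commutative ring $A$, with $\Delta(x_{ij})=\sum_l x_{il}\otimes x_{lj}$; a comodule on $\operatorname{SL}_{2,A}$ is an $A$-module $W$ with a coassociative and counital $A$-linear coaction $W\to W\otimes_A R_A$. Let $V_A=Ae_1\oplus Ae_2$ be the standard comodule, with coaction $e_j\mapsto\sum_i e_i\otimes x_{ij}$, and put $V=V_{\mathbb Z}$. For a comodule $M$ let $\operatorname{Sym}^2(M)$ be the symmetric square (the quotient of $M\otimes M$ by the elements $m\otimes n-n\otimes m$), let $\operatorname{Sym}_2(M)\subseteq M\otimes M$ be the symmetric tensors (the invariants of the swap), and, if $M$ is finitely generated and projective, let $M^*=\operatorname{Hom}_A(M,A)$ be the contragredient (dual) comodule, all with their induced coactions. Theorem. Let $W$ be a comodule on $\operatorname{SL}_{2,\mathbb Z}$. Then $W$ is finitely generated and torsion free as a $\mathbb Z$-module, with pull back $\mathbb Q\otimes_{\mathbb Z}W$ isomorphic to $\operatorname{Sym}^2(V_{\mathbb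 Q})$ as a comodule on $\operatorname{SL}_{2,\mathbb Q}$, if and only if $W$ is isomorphic, as a comodule on $\operatorname{SL}_{2,\mathbb Z}$, to one of $$\operatorname{Sym}^2(V),\quad \operatorname{Sym}^2(V)^*,\quad \operatorname{Sym}_2(V),\quad \operatorname{Sym}_2(V)^*.$$ (It is not asserted that these four comodules are pairwise non-isomorphic.) -/

import Mathlib

open scoped TensorProduct

noncomputable section

/-! ## The group scheme `SL₂` over a commutative ring, as a Hopf algebra -/

/-- The coordinate ring `A[x₁₁, x₁₂, x₂₁, x₂₂] / (x₁₁ x₂₂ - x₁₂ x₂₁ - 1)` of `SL₂` over `A`. -/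
def SL2Ring (A : Type*) [CommRing A] : Type _ :=
  MvPolynomial (Fin 2 × Fin 2) A ⧸
    Ideal.span {(MvPolynomial.X (0, 0) * MvPolynomial.X (1, 1)
      - MvPolynomial.X (0, 1) * MvPolynomial.X (1, 0) - 1 : MvPolynomial (Fin 2 × Fin 2) A)}

namespace SL2Ring

instance (A : Type*) [CommRing A] : CommRing (SL2Ring A) :=
  inferInstanceAs (CommRing (MvPolynomial (Fin 2 × Fin 2) A ⧸ _))

instance (k A : Type*) [CommRing A] [CommSemiring k] [Algebra k A] : Algebra k (SL2Ring A) :=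
  inferInstanceAs (Algebra k (MvPolynomial (Fin 2 × Fin 2) A ⧸ _))

instance (k A : Type*) [CommRing A] [CommSemiring k] [Algebra k A] :
    IsScalarTower k A (SL2Ring A) :=
  inferInstanceAs (IsScalarTower k A (MvPolynomial (Fin 2 × Fin 2) A ⧸ _))

variable (A : Type*) [CommRing A]

/-- The quotient map. -/
def mk : MvPolynomial (Fin 2 × Fin 2) A →ₐ[A] SL2Ring A :=
  Ideal.Quotient.mkₐ A (Ideal.span _)

/-- The coordinate functions `x_{ij}`. -/
def x (i j : Fin 2) : SL2Ring A := mk A (MvPolynomial.X (i, j))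

/-- The generic matrix `(x_{ij})`. -/
def gen : Matrix (Fin 2) (Fin 2) (SL2Ring A) := Matrix.of (x A)

theorem mk_eq_zero_iff (p : MvPolynomial (Fin 2 × Fin 2) A) :
    mk A p = 0 ↔ (MvPolynomial.X (0, 0) * MvPolynomial.X (1, 1)
      - MvPolynomial.X (0, 1) * MvPolynomial.X (1, 0) - 1) ∣ p :=
  Ideal.Quotient.eq_zero_iff_mem.trans Ideal.mem_span_singleton

theorem mk_surjective : Function.Surjective (mk A) := Ideal.Quotient.mk_surjective

theorem x_relation : x A 0 0 * x A 1 1 - x A 0 1 * x A 1 0 = 1 := by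
  have h := (mk_eq_zero_iff A _).2 dvd_rfl
  rw [map_sub, map_sub, map_mul, map_mul, map_one] at h
  exact sub_eq_zero.1 h

theorem det_gen : (gen A).det = 1 := by
  rw [Matrix.det_fin_two]
  exact x_relation A

variable {A}

/-- The universal property of the coordinate ring: a `B`-valued point of `SL₂` is
a matrix over `B` of determinant one. -/
def lift {B : Type*} [CommRing B] [Algebra A B]
    (m : Matrix (Fin 2) (Fin 2) B) (hm : m.det = 1) : SL2Ring A →ₐ[A] B :=
  Ideal.Quotient.liftₐ (Ideal.span {(MvPolynomial.X (0, 0) * MvPolynomial.X (1, 1)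
      - MvPolynomial.X (0, 1) * MvPolynomial.X (1, 0) - 1 : MvPolynomial (Fin 2 × Fin 2) A)})
    (MvPolynomial.aeval (R := A) fun p => m p.1 p.2) (by
      intro a ha
      obtain ⟨q, rfl⟩ := Ideal.mem_span_singleton.1 ha
      rw [Matrix.det_fin_two] at hm
      simp [hm])

theorem lift_x {B : Type*} [CommRing B]
    [Algebra A B] (m : Matrix (Fin 2) (Fin 2) B) (hm : m.det = 1)
    (i j : Fin 2) : lift (A := A) m hm (x A i j) = m i j :=
  (Ideal.Quotient.lift_mk _ _ _).trans (MvPolynomial.aeval_X _ _)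

theorem algHom_ext {B : Type*} [Semiring B] [Algebra A B] {f g : SL2Ring A →ₐ[A] B}
    (h : ∀ i j, f (x A i j) = g (x A i j)) : f = g := by
  exact Ideal.Quotient.algHom_ext A (MvPolynomial.algHom_ext fun p => h p.1 p.2)

variable (A)

/-- Comultiplication `x_{ij} ↦ ∑ₗ x_{il} ⊗ x_{lj}`. -/
def comulHom : SL2Ring A →ₐ[A] SL2Ring A ⊗[A] SL2Ring A :=
  lift (Matrix.of fun i j => x A i 0 ⊗ₜ[A] x A 0 j + x A i 1 ⊗ₜ[A] x A 1 j) (by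
    rw [Matrix.det_fin_two]
    simp only [Matrix.of_apply, add_mul, mul_add, Algebra.TensorProduct.tmul_mul_tmul]
    have h : (x A 0 0 * x A 1 1 - x A 0 1 * x A 1 0) ⊗ₜ[A]
        (x A 0 0 * x A 1 1 - x A 0 1 * x A 1 0) = 1 := by
      rw [x_relation]; rfl
    rw [← h]
    simp only [TensorProduct.sub_tmul, TensorProduct.tmul_sub, mul_comm]
    abel)

theorem comulHom_x (i j : Fin 2) :
    comulHom A (x A i j) = x A i 0 ⊗ₜ[A] x A 0 j + x A i 1 ⊗ₜ[A] x A 1 j := lift_x _ _ i j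

/-- Counit `x_{ij} ↦ δ_{ij}`. -/
def counitHom : SL2Ring A →ₐ[A] A := lift (1 : Matrix (Fin 2) (Fin 2) A) Matrix.det_one

theorem counitHom_x (i j : Fin 2) : counitHom A (x A i j) = if i = j then 1 else 0 :=
  (lift_x _ Matrix.det_one i j).trans Matrix.one_apply

/-- Antipode: `x₁₁ ↦ x₂₂`, `x₁₂ ↦ -x₁₂`, `x₂₁ ↦ -x₂₁`, `x₂₂ ↦ x₁₁`. -/
def antipodeHom : SL2Ring A →ₐ[A] SL2Ring A :=
  lift !![x A 1 1, -x A 0 1; -x A 1 0, x A 0 0] (by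
    rw [Matrix.det_fin_two_of]
    linear_combination x_relation A)

theorem antipodeHom_x00 : antipodeHom A (x A 0 0) = x A 1 1 := lift_x _ _ 0 0
theorem antipodeHom_x01 : antipodeHom A (x A 0 1) = -x A 0 1 := lift_x _ _ 0 1
theorem antipodeHom_x10 : antipodeHom A (x A 1 0) = -x A 1 0 := lift_x _ _ 1 0
theorem antipodeHom_x11 : antipodeHom A (x A 1 1) = x A 0 0 := lift_x _ _ 1 1

theorem comul_coassoc :
    (Algebra.TensorProduct.assoc A A A (SL2Ring A) (SL2Ring A) (SL2Ring A)).toAlgHom.comp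
      ((Algebra.TensorProduct.map (comulHom A) (.id A (SL2Ring A))).comp (comulHom A))
      = (Algebra.TensorProduct.map (.id A (SL2Ring A)) (comulHom A)).comp (comulHom A) := by
  refine algHom_ext fun i j => ?_
  simp [comulHom_x, TensorProduct.tmul_add, TensorProduct.add_tmul]
  abel

theorem counit_left :
    (Algebra.TensorProduct.map (counitHom A) (.id A (SL2Ring A))).comp (comulHom A)
      = (Algebra.TensorProduct.lid A (SL2Ring A)).symm := by
  refine algHom_ext fun i j => ?_
  fin_cases i <;> simp [comulHom_x, counitHom_x]

theorem counit_right :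
    (Algebra.TensorProduct.map (.id A (SL2Ring A)) (counitHom A)).comp (comulHom A)
      = (Algebra.TensorProduct.rid A A (SL2Ring A)).symm := by
  refine algHom_ext fun i j => ?_
  fin_cases j <;> simp [comulHom_x, counitHom_x]

instance : Bialgebra A (SL2Ring A) :=
  Bialgebra.ofAlgHom (comulHom A) (counitHom A) (comul_coassoc A) (counit_left A) (counit_right A)

@[simp] theorem comul_x (i j : Fin 2) :
    Coalgebra.comul (R := A) (x A i j) = x A i 0 ⊗ₜ[A] x A 0 j + x A i 1 ⊗ₜ[A] x A 1 j :=
  comulHom_x A i j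

@[simp] theorem counit_x (i j : Fin 2) :
    Coalgebra.counit (R := A) (x A i j) = if i = j then 1 else 0 :=
  counitHom_x A i j

theorem antipode_left :
    ((Algebra.TensorProduct.lift (antipodeHom A) (.id A (SL2Ring A)) fun _ _ ↦
      Commute.all _ _).comp (Bialgebra.comulAlgHom A (SL2Ring A))) =
      (Algebra.ofId A (SL2Ring A)).comp (Bialgebra.counitAlgHom A (SL2Ring A)) := by
  refine algHom_ext fun i j => ?_
  have h := x_relation A
  rw [AlgHom.comp_apply, AlgHom.comp_apply, Bialgebra.comulAlgHom_apply,
    Bialgebra.counitAlgHom_apply, comul_x, counit_x, map_add]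
  refine (congrArg₂ (· + ·) (Algebra.TensorProduct.lift_tmul _ _ (fun _ _ => Commute.all _ _) _ _)
    (Algebra.TensorProduct.lift_tmul _ _ (fun _ _ => Commute.all _ _) _ _)).trans ?_
  fin_cases i <;> fin_cases j <;>
    simp [antipodeHom_x00, antipodeHom_x01, antipodeHom_x10, antipodeHom_x11] <;> grind

theorem antipode_right :
    ((Algebra.TensorProduct.lift (.id A (SL2Ring A)) (antipodeHom A) fun _ _ ↦
      Commute.all _ _).comp (Bialgebra.comulAlgHom A (SL2Ring A))) =
      (Algebra.ofId A (SL2Ring A)).comp (Bialgebra.counitAlgHom A (SL2Ring A)) := by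
  refine algHom_ext fun i j => ?_
  have h := x_relation A
  rw [AlgHom.comp_apply, AlgHom.comp_apply, Bialgebra.comulAlgHom_apply,
    Bialgebra.counitAlgHom_apply, comul_x, counit_x, map_add]
  refine (congrArg₂ (· + ·) (Algebra.TensorProduct.lift_tmul _ _ (fun _ _ => Commute.all _ _) _ _)
    (Algebra.TensorProduct.lift_tmul _ _ (fun _ _ => Commute.all _ _) _ _)).trans ?_
  fin_cases i <;> fin_cases j <;>
    simp [antipodeHom_x00, antipodeHom_x01, antipodeHom_x10, antipodeHom_x11] <;> grind

instance : HopfAlgebra A (SL2Ring A) :=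
  HopfAlgebra.ofAlgHom (antipodeHom A) (antipode_left A) (antipode_right A)

@[simp] theorem antipode_apply (f : SL2Ring A) :
    HopfAlgebra.antipode A f = antipodeHom A f := rfl

/-- The canonical map from the coordinate ring over `A` to the one over an `A`-algebra `B`. -/
def map (B : Type*) [CommRing B] [Algebra A B] : SL2Ring A →ₐ[A] SL2Ring B :=
  lift (gen B) (det_gen B)


theorem map_x (B : Type*) [CommRing B] [Algebra A B] (i j : Fin 2) :
    map A B (x A i j) = x B i j := lift_x _ _ i j

theorem counit_map (B : Type*) [CommRing B] [Algebra A B] (f : SL2Ring A) :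
    Coalgebra.counit (R := B) (map A B f) = algebraMap A B (Coalgebra.counit (R := A) f) := by
  have h : ((Bialgebra.counitAlgHom B (SL2Ring B)).restrictScalars A).comp (map A B)
      = (Algebra.ofId A B).comp (Bialgebra.counitAlgHom A (SL2Ring A)) := by
    refine algHom_ext fun i j => ?_
    rw [AlgHom.comp_apply, AlgHom.comp_apply, map_x, AlgHom.restrictScalars_apply,
      Bialgebra.counitAlgHom_apply, Bialgebra.counitAlgHom_apply, counit_x, counit_x]
    split_ifs <;> simp
  exact DFunLike.congr_fun h f

/-- The map `R_A ⊗[A] R_A → R_B ⊗[B] R_B` induced by `SL2Ring.map`. -/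
def mapTensor (B : Type*) [CommRing B] [Algebra A B] :
    SL2Ring A ⊗[A] SL2Ring A →ₐ[A] SL2Ring B ⊗[B] SL2Ring B :=
  Algebra.TensorProduct.lift
    (((Algebra.TensorProduct.includeLeft :
      SL2Ring B →ₐ[B] SL2Ring B ⊗[B] SL2Ring B).restrictScalars A).comp (map A B))
    (((Algebra.TensorProduct.includeRight :
      SL2Ring B →ₐ[B] SL2Ring B ⊗[B] SL2Ring B).restrictScalars A).comp (map A B))
    fun _ _ => Commute.all _ _

theorem mapTensor_tmul (B : Type*) [CommRing B] [Algebra A B] (f g : SL2Ring A) :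
    mapTensor A B (f ⊗ₜ g) = map A B f ⊗ₜ map A B g := by
  refine (Algebra.TensorProduct.lift_tmul _ _ (fun _ _ => Commute.all _ _) _ _).trans ?_
  refine (Algebra.TensorProduct.tmul_mul_tmul _ _ _ _).trans ?_
  rw [one_mul, mul_one]
  rfl

theorem comul_map (B : Type*) [CommRing B] [Algebra A B] (f : SL2Ring A) :
    Coalgebra.comul (R := B) (map A B f) = mapTensor A B (Coalgebra.comul (R := A) f) := by
  have h : ((Bialgebra.comulAlgHom B (SL2Ring B)).restrictScalars A).comp (map A B)
      = (mapTensor A B).comp (Bialgebra.comulAlgHom A (SL2Ring A)) := by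
    refine algHom_ext fun i j => ?_
    rw [AlgHom.comp_apply, AlgHom.comp_apply, map_x, AlgHom.restrictScalars_apply,
      Bialgebra.comulAlgHom_apply, Bialgebra.comulAlgHom_apply, comul_x, comul_x, map_add,
      mapTensor_tmul, mapTensor_tmul, map_x, map_x, map_x, map_x]
  exact DFunLike.congr_fun h f

theorem comul_antipode (f : SL2Ring A) :
    Coalgebra.comul (R := A) (HopfAlgebra.antipode A f) =
      TensorProduct.comm A _ _ (TensorProduct.map (HopfAlgebra.antipode A)
        (HopfAlgebra.antipode A) (Coalgebra.comul (R := A) f)) := by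
  have h : (Bialgebra.comulAlgHom A (SL2Ring A)).comp (antipodeHom A) =
      ((Algebra.TensorProduct.comm A (SL2Ring A) (SL2Ring A)).toAlgHom.comp
        (Algebra.TensorProduct.map (antipodeHom A) (antipodeHom A))).comp
          (Bialgebra.comulAlgHom A (SL2Ring A)) := by
    refine algHom_ext fun i j => ?_
    fin_cases i <;> fin_cases j <;>
      simp [antipodeHom_x00, antipodeHom_x01, antipodeHom_x10, antipodeHom_x11,
        TensorProduct.neg_tmul, TensorProduct.tmul_neg] <;> abel
  exact DFunLike.congr_fun h f

instance (A : Type*) [CommRing A] [IsDomain A] [IsPrincipalIdealRing A] :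
    Module.IsTorsionFree A (SL2Ring A) := by
  refine Module.IsTorsionFree.of_smul_eq_zero fun n f hf => ?_
  by_cases hn : n = 0
  · exact Or.inl hn
  refine Or.inr ?_
  obtain ⟨p, rfl⟩ := mk_surjective A f
  rw [← map_smul, mk_eq_zero_iff, MvPolynomial.smul_eq_C_mul] at hf
  rw [mk_eq_zero_iff]
  refine IsRelPrime.dvd_of_dvd_mul_left ?_ hf
  intro d hd hdn
  obtain ⟨e, he⟩ := hdn
  have hd0 : d ≠ 0 := by
    rintro rfl
    rw [zero_mul, MvPolynomial.C_eq_zero] at he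
    exact hn he
  have he0 : e ≠ 0 := by
    rintro rfl
    rw [mul_zero, MvPolynomial.C_eq_zero] at he
    exact hn he
  have ht := MvPolynomial.totalDegree_mul_of_isDomain hd0 he0
  rw [← he, MvPolynomial.totalDegree_C] at ht
  have ht' : d.totalDegree = 0 := by omega
  rw [MvPolynomial.totalDegree_eq_zero_iff_eq_C] at ht'
  rw [ht'] at hd ⊢
  rw [MvPolynomial.C_dvd_iff_dvd_coeff] at hd
  have h0 := hd 0
  simp only [MvPolynomial.coeff_sub, MvPolynomial.coeff_zero_one,
    ← MvPolynomial.constantCoeff_eq, map_mul, MvPolynomial.constantCoeff_X] at h0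
  refine (isUnit_of_dvd_one ?_).map MvPolynomial.C
  rw [← dvd_neg]
  simpa using! h0

instance (A : Type*) [CommRing A] [IsDomain A] [IsPrincipalIdealRing A] :
    Module.Flat A (SL2Ring A) := inferInstance

end SL2Ring

/-! ## Comodules -/

/-- A comodule structure `M → M ⊗ C` over a commutative bialgebra `C` on an `A`-module `M`. -/
structure Comod (A C M : Type*) [CommRing A] [CommRing C] [Bialgebra A C]
    [AddCommGroup M] [Module A M] where
  /-- The coaction. -/
  coact : M →ₗ[A] M ⊗[A] C
  coassoc : (TensorProduct.assoc A M C C).toLinearMap ∘ₗ coact.rTensor C ∘ₗ coact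
    = (Coalgebra.comul (R := A) (A := C)).lTensor M ∘ₗ coact
  counit : (TensorProduct.rid A M).toLinearMap ∘ₗ
    (Coalgebra.counit (R := A) (A := C)).lTensor M ∘ₗ coact = LinearMap.id

namespace Comod

section General

variable {A C M N : Type*} [CommRing A] [CommRing C] [AddCommGroup M] [Module A M]
  [AddCommGroup N] [Module A N]

section Bialg

variable [Bialgebra A C]

theorem coassoc_apply (ρ : Comod A C M) (m : M) :
    TensorProduct.assoc A M C C (ρ.coact.rTensor C (ρ.coact m))
      = (Coalgebra.comul (R := A) (A := C)).lTensor M (ρ.coact m) :=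
  LinearMap.congr_fun ρ.coassoc m

theorem counit_apply (ρ : Comod A C M) (m : M) :
    TensorProduct.rid A M ((Coalgebra.counit (R := A) (A := C)).lTensor M (ρ.coact m)) = m :=
  LinearMap.congr_fun ρ.counit m

/-- Two comodules are isomorphic if there is a linear isomorphism commuting with the coactions. -/
def Iso (ρ : Comod A C M) (σ : Comod A C N) : Prop :=
  ∃ e : M ≃ₗ[A] N, σ.coact ∘ₗ e.toLinearMap = e.toLinearMap.rTensor C ∘ₗ ρ.coact

/-- The map `(M ⊗ C) ⊗ (N ⊗ C) → (M ⊗ N) ⊗ C`, `(m ⊗ c) ⊗ (n ⊗ d) ↦ (m ⊗ n) ⊗ c d`. -/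
def mulCoeff (A C M N : Type*) [CommRing A] [CommRing C] [Algebra A C] [AddCommGroup M]
    [Module A M] [AddCommGroup N] [Module A N] :
    (M ⊗[A] C) ⊗[A] (N ⊗[A] C) →ₗ[A] (M ⊗[A] N) ⊗[A] C :=
  (LinearMap.mul' A C).lTensor (M ⊗[A] N) ∘ₗ
    (TensorProduct.tensorTensorTensorComm A M C N C).toLinearMap

@[simp] theorem mulCoeff_tmul (m : M) (c : C) (n : N) (d : C) :
    mulCoeff A C M N ((m ⊗ₜ c) ⊗ₜ (n ⊗ₜ d)) = (m ⊗ₜ n) ⊗ₜ (c * d) := by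
  simp [mulCoeff]

theorem mulCoeff_comul (u : M ⊗[A] C) (v : N ⊗[A] C) :
    (Coalgebra.comul (R := A) (A := C)).lTensor (M ⊗[A] N) (mulCoeff A C M N (u ⊗ₜ v))
      = mulCoeff A (C ⊗[A] C) M N ((Coalgebra.comul (R := A) (A := C)).lTensor M u ⊗ₜ
        (Coalgebra.comul (R := A) (A := C)).lTensor N v) := by
  induction u with
  | zero => simp
  | add a b ha hb => simp only [TensorProduct.add_tmul, map_add, ha, hb]
  | tmul m c =>
    induction v with
    | zero => simp
    | add a b ha hb => simp only [TensorProduct.tmul_add, map_add, ha, hb]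
    | tmul n d => simp [Bialgebra.comul_mul]

theorem mulCoeff_counit (u : M ⊗[A] C) (v : N ⊗[A] C) :
    TensorProduct.rid A (M ⊗[A] N) ((Coalgebra.counit (R := A) (A := C)).lTensor (M ⊗[A] N)
      (mulCoeff A C M N (u ⊗ₜ v)))
      = TensorProduct.rid A M ((Coalgebra.counit (R := A) (A := C)).lTensor M u) ⊗ₜ
        TensorProduct.rid A N ((Coalgebra.counit (R := A) (A := C)).lTensor N v) := by
  induction u with
  | zero => simp
  | add a b ha hb => simp only [TensorProduct.add_tmul, map_add, ha, hb]
  | tmul m c =>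
    induction v with
    | zero => simp
    | add a b ha hb => simp only [TensorProduct.tmul_add, map_add, ha, hb]
    | tmul n d =>
      simp only [mulCoeff_tmul, LinearMap.lTensor_tmul, Bialgebra.counit_mul,
        TensorProduct.rid_tmul, TensorProduct.smul_tmul_smul]

theorem mulCoeff_assoc (a : M ⊗[A] C) (c : C) (b : N ⊗[A] C) (d : C) :
    TensorProduct.assoc A (M ⊗[A] N) C C (mulCoeff A C M N (a ⊗ₜ b) ⊗ₜ (c * d))
      = mulCoeff A (C ⊗[A] C) M N
        (TensorProduct.assoc A M C C (a ⊗ₜ c) ⊗ₜ TensorProduct.assoc A N C C (b ⊗ₜ d)) := by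
  induction a with
  | zero => simp
  | add a b ha hb => simp only [TensorProduct.add_tmul, map_add, ha, hb]
  | tmul m c' =>
    induction b with
    | zero => simp
    | add a b ha hb =>
      simp only [TensorProduct.tmul_add, TensorProduct.add_tmul, map_add, ha, hb]
    | tmul n d' => simp

theorem mulCoeff_rTensor (ρ : Comod A C M) (σ : Comod A C N) (u : M ⊗[A] C) (v : N ⊗[A] C) :
    TensorProduct.assoc A (M ⊗[A] N) C C
      ((mulCoeff A C M N ∘ₗ TensorProduct.map ρ.coact σ.coact).rTensor C
        (mulCoeff A C M N (u ⊗ₜ v)))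
      = mulCoeff A (C ⊗[A] C) M N (TensorProduct.assoc A M C C (ρ.coact.rTensor C u) ⊗ₜ
          TensorProduct.assoc A N C C (σ.coact.rTensor C v)) := by
  induction u with
  | zero => simp
  | add a b ha hb => simp only [TensorProduct.add_tmul, map_add, ha, hb]
  | tmul m c =>
    induction v with
    | zero => simp
    | add a b ha hb => simp only [TensorProduct.tmul_add, map_add, ha, hb]
    | tmul n d =>
      rw [mulCoeff_tmul, LinearMap.rTensor_tmul, LinearMap.comp_apply, TensorProduct.map_tmul,
        mulCoeff_assoc, LinearMap.rTensor_tmul, LinearMap.rTensor_tmul]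

/-- The tensor product of two comodules over a commutative bialgebra. -/
def tensor (ρ : Comod A C M) (σ : Comod A C N) : Comod A C (M ⊗[A] N) where
  coact := mulCoeff A C M N ∘ₗ TensorProduct.map ρ.coact σ.coact
  coassoc := by
    refine TensorProduct.ext' fun m n => ?_
    simp only [LinearMap.comp_apply, LinearEquiv.coe_coe, TensorProduct.map_tmul]
    rw [mulCoeff_rTensor, coassoc_apply, coassoc_apply, mulCoeff_comul]
  counit := by
    refine TensorProduct.ext' fun m n => ?_
    simp only [LinearMap.comp_apply, LinearEquiv.coe_coe, TensorProduct.map_tmul]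
    rw [mulCoeff_counit, counit_apply, counit_apply]
    rfl

theorem tensor_coact_tmul (ρ : Comod A C M) (σ : Comod A C N) (m : M) (n : N) :
    (ρ.tensor σ).coact (m ⊗ₜ n) = mulCoeff A C M N (ρ.coact m ⊗ₜ σ.coact n) := rfl

/-- A submodule `L` of a comodule `M` is a subcomodule if the coaction maps `L` into the image of
`L ⊗ C` in `M ⊗ C`. If `C` is flat then `L ⊗ C → M ⊗ C` is injective, and `L` becomes a comodule,
with the unique coaction for which the inclusion into `M` is a map of comodules. -/
def subcomod [Module.Flat A C] (ρ : Comod A C M) (L : Submodule A M)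
    (hL : ∀ m ∈ L, ρ.coact m ∈ LinearMap.range (L.subtype.rTensor C)) : Comod A C L :=
  have hinj : Function.Injective (L.subtype.rTensor C) :=
    Module.Flat.rTensor_preserves_injective_linearMap _ L.injective_subtype
  let f : L →ₗ[A] L ⊗[A] C := (LinearEquiv.ofInjective _ hinj).symm.toLinearMap ∘ₗ
      (ρ.coact ∘ₗ L.subtype).codRestrict _ fun m => hL m m.2
  have hf : L.subtype.rTensor C ∘ₗ f = ρ.coact ∘ₗ L.subtype := by
    ext m
    have := congrArg Subtype.val ((LinearEquiv.ofInjective _ hinj).apply_symm_apply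
      ((ρ.coact ∘ₗ L.subtype).codRestrict _ (fun m => hL m m.2) m))
    exact this
  { coact := f
    coassoc := by
      have hinj2 : Function.Injective (L.subtype.rTensor (C ⊗[A] C)) :=
        Module.Flat.rTensor_preserves_injective_linearMap _ L.injective_subtype
      refine LinearMap.ext fun m => hinj2 ?_
      have h1 : ∀ u : L ⊗[A] C, L.subtype.rTensor (C ⊗[A] C) (TensorProduct.assoc A L C C
          (f.rTensor C u)) = TensorProduct.assoc A M C C
            (ρ.coact.rTensor C (L.subtype.rTensor C u)) := by
        intro u
        have h2 : ∀ (w : L ⊗[A] C) (c : C), L.subtype.rTensor (C ⊗[A] C)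
            (TensorProduct.assoc A L C C (w ⊗ₜ c))
            = TensorProduct.assoc A M C C (L.subtype.rTensor C w ⊗ₜ c) := by
          intro w c
          induction w with
          | zero => simp
          | add a b ha hb => simp only [TensorProduct.add_tmul, map_add, ha, hb]
          | tmul l d => simp
        induction u with
        | zero => simp
        | add a b ha hb => simp only [map_add, ha, hb]
        | tmul l c =>
          rw [LinearMap.rTensor_tmul, h2, LinearMap.rTensor_tmul, LinearMap.rTensor_tmul]
          congr 2
          exact LinearMap.congr_fun hf l
      have h3 : ∀ u : L ⊗[A] C, L.subtype.rTensor (C ⊗[A] C)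
          ((Coalgebra.comul (R := A) (A := C)).lTensor L u) =
          (Coalgebra.comul (R := A) (A := C)).lTensor M (L.subtype.rTensor C u) := by
        intro u
        induction u with
        | zero => simp
        | add a b ha hb => simp only [map_add, ha, hb]
        | tmul l c => simp
      have hm : L.subtype.rTensor C (f m) = ρ.coact m := LinearMap.congr_fun hf m
      simp only [LinearMap.comp_apply, LinearEquiv.coe_coe]
      rw [h1, h3, hm, coassoc_apply]
    counit := by
      refine LinearMap.ext fun m => L.injective_subtype ?_
      have h3 : ∀ u : L ⊗[A] C, L.subtype (TensorProduct.rid A L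
          ((Coalgebra.counit (R := A) (A := C)).lTensor L u)) =
          TensorProduct.rid A M
            ((Coalgebra.counit (R := A) (A := C)).lTensor M (L.subtype.rTensor C u)) := by
        intro u
        induction u with
        | zero => simp
        | add a b ha hb => simp only [map_add, ha, hb]
        | tmul l c => simp
      have hm : L.subtype.rTensor C (f m) = ρ.coact m := LinearMap.congr_fun hf m
      simp only [LinearMap.comp_apply, LinearEquiv.coe_coe]
      rw [h3, hm, counit_apply]
      rfl }

theorem subcomod_coact [Module.Flat A C] (ρ : Comod A C M) (L : Submodule A M)
    (hL : ∀ m ∈ L, ρ.coact m ∈ LinearMap.range (L.subtype.rTensor C)) (m : L) :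
    L.subtype.rTensor C ((ρ.subcomod L hL).coact m) = ρ.coact m :=
  have hinj : Function.Injective (L.subtype.rTensor C) :=
    Module.Flat.rTensor_preserves_injective_linearMap _ L.injective_subtype
  congrArg Subtype.val ((LinearEquiv.ofInjective _ hinj).apply_symm_apply
      ((ρ.coact ∘ₗ L.subtype).codRestrict _ (fun m => hL m m.2) m))

/-- If `K` is a submodule with `K → M ⊗ C → (M ⧸ K) ⊗ C` zero, then the quotient `M ⧸ K` is a
comodule. -/
def quot (ρ : Comod A C M) (K : Submodule A M)
    (hK : K ≤ LinearMap.ker (K.mkQ.rTensor C ∘ₗ ρ.coact)) : Comod A C (M ⧸ K) where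
  coact := K.liftQ (K.mkQ.rTensor C ∘ₗ ρ.coact) hK
  coassoc := by
    refine Submodule.linearMap_qext _ (LinearMap.ext fun m => ?_)
    have h1 : ∀ u : M ⊗[A] C, TensorProduct.assoc A (M ⧸ K) C C
        ((K.liftQ (K.mkQ.rTensor C ∘ₗ ρ.coact) hK).rTensor C (K.mkQ.rTensor C u))
        = K.mkQ.rTensor (C ⊗[A] C) (TensorProduct.assoc A M C C (ρ.coact.rTensor C u)) := by
      intro u
      have h2 : ∀ (w : M ⊗[A] C) (c : C), K.mkQ.rTensor (C ⊗[A] C)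
          (TensorProduct.assoc A M C C (w ⊗ₜ c))
          = TensorProduct.assoc A (M ⧸ K) C C (K.mkQ.rTensor C w ⊗ₜ c) := by
        intro w c
        induction w with
        | zero => simp
        | add a b ha hb => simp only [TensorProduct.add_tmul, map_add, ha, hb]
        | tmul l d => simp
      induction u with
      | zero => simp
      | add a b ha hb => simp only [map_add, ha, hb]
      | tmul l c =>
        rw [LinearMap.rTensor_tmul, LinearMap.rTensor_tmul, LinearMap.rTensor_tmul, h2,
          Submodule.mkQ_apply, Submodule.liftQ_apply, LinearMap.comp_apply]
    have h3 : ∀ u : M ⊗[A] C, (Coalgebra.comul (R := A) (A := C)).lTensor (M ⧸ K)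
        (K.mkQ.rTensor C u) = K.mkQ.rTensor (C ⊗[A] C)
          ((Coalgebra.comul (R := A) (A := C)).lTensor M u) := by
      intro u
      induction u with
      | zero => simp
      | add a b ha hb => simp only [map_add, ha, hb]
      | tmul l c => simp
    simp only [LinearMap.comp_apply, LinearEquiv.coe_coe, Submodule.mkQ_apply,
      Submodule.liftQ_apply]
    rw [h1, h3, coassoc_apply]
  counit := by
    refine Submodule.linearMap_qext _ (LinearMap.ext fun m => ?_)
    have h3 : ∀ u : M ⊗[A] C, TensorProduct.rid A (M ⧸ K)
        ((Coalgebra.counit (R := A) (A := C)).lTensor (M ⧸ K) (K.mkQ.rTensor C u))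
        = K.mkQ (TensorProduct.rid A M ((Coalgebra.counit (R := A) (A := C)).lTensor M u)) := by
      intro u
      induction u with
      | zero => simp
      | add a b ha hb => simp only [map_add, ha, hb]
      | tmul l c => simp
    simp only [LinearMap.comp_apply, LinearEquiv.coe_coe, Submodule.mkQ_apply,
      Submodule.liftQ_apply]
    rw [h3, counit_apply]
    rfl

theorem mulCoeff_comm (u : M ⊗[A] C) (v : N ⊗[A] C) :
    (TensorProduct.comm A M N).toLinearMap.rTensor C (mulCoeff A C M N (u ⊗ₜ v))
      = mulCoeff A C N M (v ⊗ₜ u) := by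
  induction u with
  | zero => simp
  | add a b ha hb => simp only [TensorProduct.add_tmul, TensorProduct.tmul_add, map_add, ha, hb]
  | tmul m c =>
    induction v with
    | zero => simp
    | add a b ha hb => simp only [TensorProduct.tmul_add, TensorProduct.add_tmul, map_add, ha, hb]
    | tmul n d => simp [mul_comm]

theorem tensor_coact_comm (ρ : Comod A C M) (σ : Comod A C N) (t : M ⊗[A] N) :
    (σ.tensor ρ).coact (TensorProduct.comm A M N t)
      = (TensorProduct.comm A M N).toLinearMap.rTensor C ((ρ.tensor σ).coact t) := by
  induction t with
  | zero => simp
  | add a b ha hb => simp only [map_add, ha, hb]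
  | tmul m n =>
    rw [TensorProduct.comm_tmul, tensor_coact_tmul, tensor_coact_tmul, mulCoeff_comm]

end Bialg

/-- The submodule of `M ⊗ M` generated by the elements `m ⊗ n - n ⊗ m`. -/
def symRel (A M : Type*) [CommRing A] [AddCommGroup M] [Module A M] : Submodule A (M ⊗[A] M) :=
  Submodule.span A (Set.range fun p : M × M => p.1 ⊗ₜ[A] p.2 - p.2 ⊗ₜ[A] p.1)

/-- The symmetric square `Sym²(M)`, the quotient of `M ⊗ M` by the elements `m ⊗ n - n ⊗ m`. -/
abbrev SymSq (A M : Type*) [CommRing A] [AddCommGroup M] [Module A M] : Type _ :=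
  (M ⊗[A] M) ⧸ symRel A M

/-- The symmetric tensors `Sym₂(M)`, the invariants of the swap on `M ⊗ M`. -/
def SymTensors (A M : Type*) [CommRing A] [AddCommGroup M] [Module A M] :
    Submodule A (M ⊗[A] M) :=
  LinearMap.ker ((TensorProduct.comm A M M).toLinearMap - LinearMap.id)

theorem mem_symTensors (t : M ⊗[A] M) : t ∈ SymTensors A M ↔ TensorProduct.comm A M M t = t :=
  sub_eq_zero

variable [Bialgebra A C]

theorem symRel_le (ρ : Comod A C M) :
    symRel A M ≤ LinearMap.ker ((symRel A M).mkQ.rTensor C ∘ₗ (ρ.tensor ρ).coact) := by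
  refine Submodule.span_le.2 ?_
  rintro _ ⟨⟨m, n⟩, rfl⟩
  have h : (symRel A M).mkQ ∘ₗ (TensorProduct.comm A M M).toLinearMap = (symRel A M).mkQ := by
    refine TensorProduct.ext' fun a b => ?_
    refine (Submodule.Quotient.eq _).2 (Submodule.subset_span ⟨(b, a), rfl⟩)
  simp only [SetLike.mem_coe, LinearMap.mem_ker, LinearMap.comp_apply, map_sub]
  rw [← TensorProduct.comm_tmul A M M m n, tensor_coact_comm, ← LinearMap.rTensor_comp_apply, h,
    sub_self]

/-- The symmetric square of a comodule. -/
def symSq (ρ : Comod A C M) : Comod A C (SymSq A M) :=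
  (ρ.tensor ρ).quot (symRel A M) (symRel_le ρ)

theorem symTensors_le [Module.Flat A C] (ρ : Comod A C M) (t : M ⊗[A] M)
    (ht : t ∈ SymTensors A M) :
    (ρ.tensor ρ).coact t ∈ LinearMap.range ((SymTensors A M).subtype.rTensor C) := by
  have hex : Function.Exact (SymTensors A M).subtype
      ((TensorProduct.comm A M M).toLinearMap - LinearMap.id : M ⊗[A] M →ₗ[A] M ⊗[A] M) :=
    LinearMap.exact_subtype_ker_map _
  have h := (Module.Flat.rTensor_exact C hex ((ρ.tensor ρ).coact t)).1
  refine h ?_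
  rw [LinearMap.rTensor_sub, LinearMap.rTensor_id, LinearMap.sub_apply, ← tensor_coact_comm,
    (mem_symTensors t).1 ht, LinearMap.id_apply, sub_self]

/-- The comodule of symmetric tensors `Sym₂(M) ⊆ M ⊗ M` of a comodule over a flat bialgebra. -/
def symTensors [Module.Flat A C] (ρ : Comod A C M) : Comod A C (SymTensors A M) :=
  (ρ.tensor ρ).subcomod (SymTensors A M) (symTensors_le ρ)

end General

section SL2

variable {A M : Type*} [CommRing A] [AddCommGroup M] [Module A M]

/-- For `f` a linear form on `M`, the map `M → R`, `m ↦ ∑ f(mᵢ) S(aᵢ)`, where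
`∑ mᵢ ⊗ aᵢ` is the coaction on `m`: on points, it is `g ↦ f (g⁻¹ m)`. -/
def dualCoeff (ρ : Comod A (SL2Ring A) M) : Module.Dual A M →ₗ[A] M →ₗ[A] SL2Ring A where
  toFun f := HopfAlgebra.antipode A ∘ₗ (TensorProduct.lid A (SL2Ring A)).toLinearMap ∘ₗ
    f.rTensor (SL2Ring A) ∘ₗ ρ.coact
  map_add' f g := by
    simp only [LinearMap.rTensor_add, LinearMap.add_comp, LinearMap.comp_add]
  map_smul' a f := by
    simp only [LinearMap.rTensor_smul, LinearMap.smul_comp, LinearMap.comp_smul,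
      RingHom.id_apply]

theorem dualCoeff_apply (ρ : Comod A (SL2Ring A) M) (f : Module.Dual A M) (m : M) :
    dualCoeff ρ f m = HopfAlgebra.antipode A
      (TensorProduct.lid A (SL2Ring A) (f.rTensor (SL2Ring A) (ρ.coact m))) := rfl

/-- The coaction on the dual: `dualCoeff` under the isomorphism `M* ⊗ R ≃ Hom(M, R)`. -/
def dualCoact [Module.Finite A M] [Module.Projective A M] (ρ : Comod A (SL2Ring A) M) :
    Module.Dual A M →ₗ[A] Module.Dual A M ⊗[A] SL2Ring A :=
  (dualTensorHomEquiv A M (SL2Ring A)).symm.toLinearMap ∘ₗ dualCoeff ρ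

theorem dualTensorHom_dualCoact [Module.Finite A M] [Module.Projective A M]
    (ρ : Comod A (SL2Ring A) M) (f : Module.Dual A M) :
    dualTensorHom A M (SL2Ring A) (dualCoact ρ f) = dualCoeff ρ f :=
  (dualTensorHomEquiv A M (SL2Ring A)).apply_symm_apply _

/-- The contragredient (dual) comodule structure on `M* = Hom(M, A)`, for `M` finitely generated
and projective. (A coaction `M* → M* ⊗ R` over `R` is the same thing, via the flip, as a coaction
`M* → R ⊗ M*` over the opposite Hopf algebra of `R`.) -/
def dual [Module.Finite A M] [Module.Projective A M] (ρ : Comod A (SL2Ring A) M) :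
    Comod A (SL2Ring A) (Module.Dual A M) where
  coact := dualCoact ρ
  coassoc := by
    refine LinearMap.ext fun f => ?_
    refine (dualTensorHom_bijective (R := A) (M := M)
      (N := SL2Ring A ⊗[A] SL2Ring A)).1 (LinearMap.ext fun m => ?_)
    simp only [LinearMap.comp_apply, LinearEquiv.coe_coe]
    have h1 : ∀ z : Module.Dual A M ⊗[A] SL2Ring A,
        dualTensorHom A M (SL2Ring A ⊗[A] SL2Ring A)
          ((Coalgebra.comul (R := A) (A := SL2Ring A)).lTensor (Module.Dual A M) z) m
        = Coalgebra.comul (R := A) (dualTensorHom A M (SL2Ring A) z m) := by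
      intro z
      induction z with
      | zero => simp
      | add a b ha hb => simp only [map_add, LinearMap.add_apply, ha, hb]
      | tmul g c => simp
    let S : SL2Ring A →ₗ[A] SL2Ring A := HopfAlgebra.antipode A
    let ψ : (M →ₗ[A] SL2Ring A) →ₗ[A] M ⊗[A] SL2Ring A →ₗ[A] SL2Ring A ⊗[A] SL2Ring A :=
      LinearMap.mk₂ A (fun k u => TensorProduct.comm A _ _ (TensorProduct.map k S u))
        (fun k l u => by simp [TensorProduct.map_add_left])
        (fun a k u => by simp [TensorProduct.map_smul_left])
        (fun k u v => by simp) (fun a k u => by simp)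
    have h2 : ∀ z : Module.Dual A M ⊗[A] SL2Ring A,
        dualTensorHom A M (SL2Ring A ⊗[A] SL2Ring A)
          (TensorProduct.assoc A _ _ _ ((dualCoact ρ).rTensor (SL2Ring A) z)) m
        = ψ (dualTensorHom A M (SL2Ring A) z) (ρ.coact m) := by
      intro z
      induction z with
      | zero => simp
      | add a b ha hb => simp only [map_add, LinearMap.add_apply, ha, hb]
      | tmul g c =>
        rw [LinearMap.rTensor_tmul]
        have h3 : ∀ y : Module.Dual A M ⊗[A] SL2Ring A,
            dualTensorHom A M (SL2Ring A ⊗[A] SL2Ring A)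
              (TensorProduct.assoc A _ _ _ (y ⊗ₜ c)) m
            = dualTensorHom A M (SL2Ring A) y m ⊗ₜ c := by
          intro y
          induction y with
          | zero => simp
          | add a b ha hb =>
            simp only [TensorProduct.add_tmul, map_add, LinearMap.add_apply, ha, hb]
          | tmul g c => simp [TensorProduct.smul_tmul']
        rw [h3, dualTensorHom_dualCoact, dualCoeff_apply]
        generalize ρ.coact m = u
        change _ = TensorProduct.comm A _ _ (TensorProduct.map _ S u)
        induction u with
        | zero => simp
        | add a b ha hb => simp only [map_add, TensorProduct.add_tmul, ha, hb]
        | tmul n d =>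
          simp [S, TensorProduct.smul_tmul]
    rw [h1, h2, dualTensorHom_dualCoact, dualCoeff_apply]
    rw [show ∀ c, Coalgebra.comul (R := A) (HopfAlgebra.antipode A c) = _ from
      SL2Ring.comul_antipode A]
    have h4 : ∀ u : M ⊗[A] SL2Ring A, Coalgebra.comul (R := A)
        (TensorProduct.lid A (SL2Ring A) (f.rTensor (SL2Ring A) u))
        = TensorProduct.lid A (SL2Ring A ⊗[A] SL2Ring A)
          (f.rTensor _ ((Coalgebra.comul (R := A) (A := SL2Ring A)).lTensor M u)) := by
      intro u
      induction u with
      | zero => simp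
      | add a b ha hb => simp only [map_add, ha, hb]
      | tmul n d => simp
    rw [h4, ← coassoc_apply]
    generalize ρ.coact m = u
    change TensorProduct.comm A _ _ (TensorProduct.map _ S u) = _
    congr 1
    induction u with
    | zero => simp
    | add a b ha hb => simp only [map_add, ha, hb]
    | tmul n d =>
      rw [TensorProduct.map_tmul, dualCoeff_apply, LinearMap.rTensor_tmul]
      generalize ρ.coact n = v
      induction v with
      | zero => simp
      | add a b ha hb => simp only [map_add, TensorProduct.add_tmul, ha, hb]
      | tmul n' d' => simp [S, TensorProduct.smul_tmul']
  counit := by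
    refine LinearMap.ext fun f => LinearMap.ext fun m => ?_
    simp only [LinearMap.comp_apply, LinearEquiv.coe_coe, LinearMap.id_apply]
    have h1 : ∀ z : Module.Dual A M ⊗[A] SL2Ring A,
        TensorProduct.rid A (Module.Dual A M)
          ((Coalgebra.counit (R := A) (A := SL2Ring A)).lTensor (Module.Dual A M) z) m
        = Coalgebra.counit (R := A) (dualTensorHom A M (SL2Ring A) z m) := by
      intro z
      induction z with
      | zero => simp
      | add a b ha hb => simp only [map_add, LinearMap.add_apply, ha, hb]
      | tmul g c => simp [mul_comm]
    rw [h1, dualTensorHom_dualCoact, dualCoeff_apply, HopfAlgebra.counit_antipode]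
    conv_rhs => rw [← ρ.counit_apply m]
    generalize ρ.coact m = u
    induction u with
    | zero => simp
    | add a b ha hb => simp only [map_add, ha, hb]
    | tmul n d => simp [mul_comm]

/-- The map `M ⊗[A] R_A → (B ⊗[A] M) ⊗[B] R_B`, `m ⊗ f ↦ (1 ⊗ m) ⊗ f`. -/
def extendCoeff (A B M : Type*) [CommRing A] [CommRing B] [Algebra A B] [AddCommGroup M]
    [Module A M] : M ⊗[A] SL2Ring A →ₗ[A] (B ⊗[A] M) ⊗[B] SL2Ring B :=
  TensorProduct.lift (LinearMap.mk₂ A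
    (fun m f => ((1 : B) ⊗ₜ[A] m) ⊗ₜ[B] SL2Ring.map A B f)
    (fun m n f => by rw [TensorProduct.tmul_add, TensorProduct.add_tmul])
    (fun a m f => by rw [TensorProduct.tmul_smul]; exact (TensorProduct.smul_tmul' a _ _).symm)
    (fun m f g => by rw [map_add, TensorProduct.tmul_add])
    (fun a m f => by
      rw [map_smul, ← algebraMap_smul B a (SL2Ring.map A B f), TensorProduct.tmul_smul,
        algebraMap_smul]))

theorem extendCoeff_tmul (B : Type*) [CommRing B] [Algebra A B] (m : M) (f : SL2Ring A) :
    extendCoeff A B M (m ⊗ₜ f) = ((1 : B) ⊗ₜ[A] m) ⊗ₜ[B] SL2Ring.map A B f := rfl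

/-- The base change (pull back) of a comodule on `SL₂` over `A` to a comodule on `SL₂` over an
`A`-algebra `B`. -/
def baseChange (B : Type*) [CommRing B] [Algebra A B] (ρ : Comod A (SL2Ring A) M) :
    Comod B (SL2Ring B) (B ⊗[A] M) where
  coact := (extendCoeff A B M ∘ₗ ρ.coact).liftBaseChange B
  coassoc := by
    refine TensorProduct.AlgebraTensorModule.curry_injective (LinearMap.ext_ring ?_)
    refine LinearMap.ext fun m => ?_
    change TensorProduct.assoc B _ _ _ (LinearMap.rTensor _ _
      ((extendCoeff A B M ∘ₗ ρ.coact).liftBaseChange B ((1 : B) ⊗ₜ[A] m))) =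
      LinearMap.lTensor _ _ ((extendCoeff A B M ∘ₗ ρ.coact).liftBaseChange B ((1 : B) ⊗ₜ[A] m))
    rw [LinearMap.liftBaseChange_tmul, one_smul, LinearMap.comp_apply]
    let Θ : M ⊗[A] (SL2Ring A ⊗[A] SL2Ring A) →ₗ[A]
        (B ⊗[A] M) ⊗[B] (SL2Ring B ⊗[B] SL2Ring B) :=
      TensorProduct.lift (LinearMap.mk₂ A
        (fun m f => ((1 : B) ⊗ₜ[A] m) ⊗ₜ[B] SL2Ring.mapTensor A B f)
        (fun m n f => by rw [TensorProduct.tmul_add, TensorProduct.add_tmul])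
        (fun a m f => by rw [TensorProduct.tmul_smul]; exact (TensorProduct.smul_tmul' a _ _).symm)
        (fun m f g => by rw [map_add, TensorProduct.tmul_add])
        (fun a m f => by
          rw [map_smul, ← algebraMap_smul B a (SL2Ring.mapTensor A B f), TensorProduct.tmul_smul,
            algebraMap_smul]))
    have hΘ : ∀ m f, Θ (m ⊗ₜ f) = ((1 : B) ⊗ₜ[A] m) ⊗ₜ[B] SL2Ring.mapTensor A B f :=
      fun _ _ => rfl
    have h1 : ∀ u : M ⊗[A] SL2Ring A,
        (Coalgebra.comul (R := B) (A := SL2Ring B)).lTensor (B ⊗[A] M) (extendCoeff A B M u)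
        = Θ ((Coalgebra.comul (R := A) (A := SL2Ring A)).lTensor M u) := by
      intro u
      induction u with
      | zero => simp
      | add a b ha hb => simp only [map_add, ha, hb]
      | tmul n d =>
        rw [extendCoeff_tmul, LinearMap.lTensor_tmul, LinearMap.lTensor_tmul, hΘ,
          SL2Ring.comul_map]
    have h2 : ∀ u : M ⊗[A] SL2Ring A,
        TensorProduct.assoc B _ _ _
          (((extendCoeff A B M ∘ₗ ρ.coact).liftBaseChange B).rTensor (SL2Ring B)
            (extendCoeff A B M u))
        = Θ (TensorProduct.assoc A _ _ _ (ρ.coact.rTensor (SL2Ring A) u)) := by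
      intro u
      induction u with
      | zero => simp
      | add a b ha hb => simp only [map_add, ha, hb]
      | tmul n d =>
        rw [extendCoeff_tmul, LinearMap.rTensor_tmul, LinearMap.rTensor_tmul,
          LinearMap.liftBaseChange_tmul, one_smul, LinearMap.comp_apply]
        generalize ρ.coact n = v
        induction v with
        | zero => simp
        | add a b ha hb => simp only [map_add, TensorProduct.add_tmul, ha, hb]
        | tmul n' d' =>
          rw [extendCoeff_tmul, TensorProduct.assoc_tmul, TensorProduct.assoc_tmul, hΘ,
            SL2Ring.mapTensor_tmul]
    rw [h1, h2, coassoc_apply]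
  counit := by
    refine TensorProduct.AlgebraTensorModule.curry_injective (LinearMap.ext_ring ?_)
    refine LinearMap.ext fun m => ?_
    change TensorProduct.rid B _ (LinearMap.lTensor _ _
      ((extendCoeff A B M ∘ₗ ρ.coact).liftBaseChange B ((1 : B) ⊗ₜ[A] m))) = (1 : B) ⊗ₜ[A] m
    rw [LinearMap.liftBaseChange_tmul, one_smul, LinearMap.comp_apply]
    have h1 : ∀ u : M ⊗[A] SL2Ring A, TensorProduct.rid B (B ⊗[A] M)
        ((Coalgebra.counit (R := B) (A := SL2Ring B)).lTensor (B ⊗[A] M) (extendCoeff A B M u))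
        = (1 : B) ⊗ₜ[A] TensorProduct.rid A M
          ((Coalgebra.counit (R := A) (A := SL2Ring A)).lTensor M u) := by
      intro u
      induction u with
      | zero => simp
      | add a b ha hb => simp only [map_add, TensorProduct.tmul_add, ha, hb]
      | tmul n d =>
        rw [extendCoeff_tmul, LinearMap.lTensor_tmul, LinearMap.lTensor_tmul,
          TensorProduct.rid_tmul, TensorProduct.rid_tmul, SL2Ring.counit_map, algebraMap_smul,
          TensorProduct.tmul_smul]
    rw [h1, counit_apply]

/-- The standard comodule `V = A e₁ ⊕ A e₂`, with coaction `eⱼ ↦ ∑ᵢ eᵢ ⊗ x_{ij}`. -/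
def standard (A : Type*) [CommRing A] : Comod A (SL2Ring A) (Fin 2 → A) where
  coact := (Pi.basisFun A (Fin 2)).constr A fun j =>
    ∑ i, Pi.basisFun A (Fin 2) i ⊗ₜ[A] SL2Ring.x A i j
  coassoc := by
    refine (Pi.basisFun A (Fin 2)).ext fun j => ?_
    simp only [LinearMap.comp_apply, LinearEquiv.coe_coe, Module.Basis.constr_basis,
      Fin.sum_univ_two, map_add, LinearMap.rTensor_tmul, LinearMap.lTensor_tmul,
      TensorProduct.add_tmul, TensorProduct.tmul_add, TensorProduct.assoc_tmul,
      SL2Ring.comul_x]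
    abel
  counit := by
    refine (Pi.basisFun A (Fin 2)).ext fun j => ?_
    simp only [LinearMap.comp_apply, LinearEquiv.coe_coe, Module.Basis.constr_basis,
      Fin.sum_univ_two, map_add, LinearMap.lTensor_tmul, TensorProduct.rid_tmul,
      SL2Ring.counit_x, LinearMap.id_apply]
    fin_cases j <;> simp

end SL2

section Free

variable (A : Type*) [CommRing A]

/-- Coordinates on the symmetric square of `A e₁ ⊕ A e₂` with respect to `e₁²`, `e₁ e₂`, `e₂²`. -/
def symSqCoord : SymSq A (Fin 2 → A) →ₗ[A] (Fin 3 → A) :=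
  (symRel A (Fin 2 → A)).liftQ (TensorProduct.lift (LinearMap.mk₂ A
      (fun v w => ![v 0 * w 0, v 0 * w 1 + v 1 * w 0, v 1 * w 1])
      (fun u v w => by ext i; fin_cases i <;> simp <;> ring)
      (fun a v w => by ext i; fin_cases i <;> simp <;> ring)
      (fun u v w => by ext i; fin_cases i <;> simp <;> ring)
      (fun a v w => by ext i; fin_cases i <;> simp <;> ring))) (by
    refine Submodule.span_le.2 ?_
    rintro _ ⟨⟨v, w⟩, rfl⟩
    simp only [SetLike.mem_coe, LinearMap.mem_ker, map_sub, TensorProduct.lift.tmul,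
      LinearMap.mk₂_apply]
    ext i; fin_cases i <;> simp <;> ring)

theorem symSqCoord_mk (v w : Fin 2 → A) : symSqCoord A ((symRel A _).mkQ (v ⊗ₜ w))
    = ![v 0 * w 0, v 0 * w 1 + v 1 * w 0, v 1 * w 1] := rfl

/-- The symmetric square of `A e₁ ⊕ A e₂` is free on `e₁²`, `e₁ e₂`, `e₂²`. -/
def symSqEquiv : SymSq A (Fin 2 → A) ≃ₗ[A] (Fin 3 → A) :=
  LinearEquiv.ofLinearMap (symSqCoord A)
    ((Pi.basisFun A (Fin 3)).constr A
      ![(symRel A _).mkQ (Pi.basisFun A (Fin 2) 0 ⊗ₜ Pi.basisFun A (Fin 2) 0),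
        (symRel A _).mkQ (Pi.basisFun A (Fin 2) 0 ⊗ₜ Pi.basisFun A (Fin 2) 1),
        (symRel A _).mkQ (Pi.basisFun A (Fin 2) 1 ⊗ₜ Pi.basisFun A (Fin 2) 1)])
    (by
      refine (Pi.basisFun A (Fin 3)).ext fun j => ?_
      rw [LinearMap.comp_apply, Module.Basis.constr_basis]
      fin_cases j
      · refine (symSqCoord_mk A _ _).trans ?_
        ext i; fin_cases i <;> simp
      · refine (symSqCoord_mk A _ _).trans ?_
        ext i; fin_cases i <;> simp
      · refine (symSqCoord_mk A _ _).trans ?_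
        ext i; fin_cases i <;> simp)
    (by
      refine Submodule.linearMap_qext _ ?_
      refine ((Pi.basisFun A (Fin 2)).tensorProduct (Pi.basisFun A (Fin 2))).ext ?_
      have h : (symRel A (Fin 2 → A)).mkQ
          (Pi.basisFun A (Fin 2) 0 ⊗ₜ Pi.basisFun A (Fin 2) 1) = (symRel A (Fin 2 → A)).mkQ
          (Pi.basisFun A (Fin 2) 1 ⊗ₜ Pi.basisFun A (Fin 2) 0) :=
        (Submodule.Quotient.eq _).2 (Submodule.subset_span ⟨(_, _), rfl⟩)
      rintro ⟨i, j⟩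
      rw [Module.Basis.tensorProduct_apply, LinearMap.comp_apply, LinearMap.comp_apply,
        symSqCoord_mk, LinearMap.comp_apply, LinearMap.id_apply,
        Module.Basis.constr_apply_fintype, Fin.sum_univ_three]
      fin_cases i <;> fin_cases j <;> simp at h ⊢
      exact h)

instance : Module.Free A (SymSq A (Fin 2 → A)) := Module.Free.of_equiv (symSqEquiv A).symm

instance [IsDomain A] [IsPrincipalIdealRing A] : Module.Finite A (SymTensors A (Fin 2 → A)) :=
  inferInstance

instance [IsDomain A] [IsPrincipalIdealRing A] : Module.Free A (SymTensors A (Fin 2 → A)) :=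
  Module.Free.of_basis (Submodule.basisOfPid
    ((Pi.basisFun A (Fin 2)).tensorProduct (Pi.basisFun A (Fin 2))) (SymTensors A _)).2

end Free

end Comod

end

/-! Comodules that are free over the base are handled through their coefficient matrices
(`Comod.HasMatrix`): two comodules with the same matrix in some bases are isomorphic, and base
change and duality are visible on matrices. Of the four comodules of the statement, `Sym²(V)` has
the matrix `symSqMatrix` and `Sym₂(V)` the matrix `symTensorsMatrix`. The antipode exchanges the two
shapes up to reversal and signs, so `Sym²(V)*` has the matrix of `Sym₂(V)` and `Sym₂(V)*` that of
`Sym²(V)`. Where `2` is invertible the two matrices differ by a rescaling of the middle basis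
vector, so that all four comodules become `Sym²` over `ℚ`.

Conversely, let `W` be a lattice in `Sym²(ℚ²)` with basis `e₁²`, `e₁ e₂`, `e₂²`. The Taylor
coefficients of the coaction along the unipotent one-parameter subgroups are defined over `ℤ`, so
`W` is stable under the divided powers `E`, `E⁽²⁾`, `F`, `F⁽²⁾` of the nilpotent elements of the Lie
algebra. Since `E⁽²⁾ F⁽²⁾` and `F⁽²⁾ E⁽²⁾` are the projections to the extreme weight spaces, `W` is
the direct sum of its intersections with the weight lines. The extreme ones are identified by
`E⁽²⁾` and `F⁽²⁾`, and are both `αℤ` for some `α`; the operator `E` maps the middle one into `αℤ`,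
and `F` shows that it contains `2αℤ`. Hence `W` is spanned by `α e₁²`, `d α e₁ e₂`, `α e₂²` with `d`
equal to `1` or `2` (`exists_weight_basis`), and its coefficient matrix in this basis is
`symSqMatrix` or `symTensorsMatrix` over `ℚ`, hence over `ℤ` because `R_ℤ → R_ℚ` is injective
(`SL2Ring.map_injective`). -/

open scoped TensorProduct

noncomputable section

/-! ### Coefficient matrices -/

namespace Comod

section Matrix

variable {A C M N ι : Type*} [CommRing A] [CommRing C] [Bialgebra A C] [AddCommGroup M]
  [Module A M] [AddCommGroup N] [Module A N] [Fintype ι]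

/-- The comodule `ρ` has coefficient matrix `T` in the basis `b`: the coaction is
`b j ↦ ∑ i, b i ⊗ T i j`. -/
def HasMatrix (ρ : Comod A C M) (b : Module.Basis ι A M) (T : Matrix ι ι C) : Prop :=
  ∀ j, ρ.coact (b j) = ∑ i, b i ⊗ₜ[A] T i j

namespace HasMatrix

variable {ρ : Comod A C M} {σ : Comod A C N} {b : Module.Basis ι A M} {T : Matrix ι ι C}

theorem exists_of_basis (ρ : Comod A C M) (b : Module.Basis ι A M) :
    ∃ T, ρ.HasMatrix b T := by
  refine ⟨Matrix.of fun i j =>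
    TensorProduct.lid A C ((b.coord i).rTensor C (ρ.coact (b j))), fun j => ?_⟩
  change ρ.coact (b j) = ∑ i, b i ⊗ₜ[A] TensorProduct.lid A C
    ((b.coord i).rTensor C (ρ.coact (b j)))
  generalize ρ.coact (b j) = u
  induction u with
  | zero => simp
  | add x y hx hy =>
    simp only [map_add, TensorProduct.tmul_add, Finset.sum_add_distrib, ← hx, ← hy]
  | tmul m c =>
    simp only [LinearMap.rTensor_tmul, TensorProduct.lid_tmul, ← TensorProduct.smul_tmul,
      ← TensorProduct.sum_tmul, Module.Basis.coord_apply]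
    rw [b.sum_repr]

theorem lid_coord (h : ρ.HasMatrix b T) (i j : ι) :
    TensorProduct.lid A C ((b.coord i).rTensor C (ρ.coact (b j))) = T i j := by
  classical
  rw [h j]
  simp [Finsupp.single_apply]

theorem unique {T' : Matrix ι ι C} (h : ρ.HasMatrix b T) (h' : ρ.HasMatrix b T') : T = T' := by
  ext i j
  rw [← h.lid_coord, ← h'.lid_coord]

/-- A linear isomorphism matching two bases with the same coefficient matrix is a map of
comodules. -/
theorem iso {b' : Module.Basis ι A N} (h : ρ.HasMatrix b T) (h' : σ.HasMatrix b' T) :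
    ρ.Iso σ := by
  refine ⟨b.equiv b' (Equiv.refl ι), b.ext fun j => ?_⟩
  simp [h j, h' j]

theorem map {e : M ≃ₗ[A] N} (h : ρ.HasMatrix b T)
    (he : σ.coact ∘ₗ e.toLinearMap = e.toLinearMap.rTensor C ∘ₗ ρ.coact) :
    σ.HasMatrix (b.map e) T := fun j => by
  have := LinearMap.congr_fun he (b j)
  simp only [LinearMap.comp_apply, LinearEquiv.coe_coe] at this
  simp [this, h j]

/-- Change of basis along a monomial matrix. -/
theorem monomial (h : ρ.HasMatrix b T) (τ : Equiv.Perm ι) (c : ι → A)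
    {b' : Module.Basis ι A M} {T' : Matrix ι ι C} (hb : ∀ j, b' j = c j • b (τ j))
    (hT : ∀ i j, c j • T (τ i) (τ j) = c i • T' i j) : ρ.HasMatrix b' T' := fun j => by
  rw [hb, map_smul, h, ← Equiv.sum_comp τ, Finset.smul_sum]
  refine Finset.sum_congr rfl fun i _ => ?_
  rw [hb, ← TensorProduct.tmul_smul, hT, TensorProduct.tmul_smul, TensorProduct.smul_tmul']

end HasMatrix

theorem Iso.symm {ρ : Comod A C M} {σ : Comod A C N} (h : ρ.Iso σ) : σ.Iso ρ := by
  obtain ⟨e, he⟩ := h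
  refine ⟨e.symm, LinearMap.ext fun n => ?_⟩
  obtain ⟨m, rfl⟩ := e.surjective n
  have := LinearMap.congr_fun he m
  simp only [LinearMap.comp_apply, LinearEquiv.coe_coe] at this
  simp [this, ← LinearMap.rTensor_comp_apply]

theorem Iso.exists_hasMatrix {ρ : Comod A C M} {σ : Comod A C N} (h : ρ.Iso σ)
    {b : Module.Basis ι A N} {T : Matrix ι ι C} (hb : σ.HasMatrix b T) :
    ∃ b' : Module.Basis ι A M, ρ.HasMatrix b' T := by
  obtain ⟨e, he⟩ := h.symm
  exact ⟨b.map e, hb.map he⟩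

end Matrix

/-! ### The action of linear forms on the bialgebra -/

section Action

variable {A C M N ι : Type*} [CommRing A] [CommRing C] [Bialgebra A C] [AddCommGroup M]
  [Module A M] [AddCommGroup N] [Module A N] [Fintype ι]

/-- The action on a comodule of a linear form `l` on the bialgebra: `m ↦ ∑ l(aᵢ) mᵢ`, where
`∑ mᵢ ⊗ aᵢ` is the coaction on `m`. -/
def act (ρ : Comod A C M) (l : C →ₗ[A] A) : M →ₗ[A] M :=
  (TensorProduct.rid A M).toLinearMap ∘ₗ l.lTensor M ∘ₗ ρ.coact

theorem act_apply (ρ : Comod A C M) (l : C →ₗ[A] A) (m : M) :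
    ρ.act l m = TensorProduct.rid A M (l.lTensor M (ρ.coact m)) := rfl

theorem act_equiv {ρ : Comod A C M} {σ : Comod A C N} {e : M ≃ₗ[A] N}
    (he : σ.coact ∘ₗ e.toLinearMap = e.toLinearMap.rTensor C ∘ₗ ρ.coact) (l : C →ₗ[A] A)
    (m : M) : σ.act l (e m) = e (ρ.act l m) := by
  have := LinearMap.congr_fun he m
  simp only [LinearMap.comp_apply, LinearEquiv.coe_coe] at this
  rw [act_apply, this, act_apply]
  generalize ρ.coact m = u
  induction u with
  | zero => simp
  | add x y hx hy => simp only [map_add, hx, hy]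
  | tmul m c => simp

theorem HasMatrix.repr_act {ρ : Comod A C M} {b : Module.Basis ι A M} {T : Matrix ι ι C}
    (h : ρ.HasMatrix b T) (l : C →ₗ[A] A) (m : M) (i : ι) :
    b.repr (ρ.act l m) i = ∑ j, l (T i j) * b.repr m j := by
  classical
  have hb : ∀ j, b.repr (ρ.act l (b j)) i = l (T i j) := fun j => by
    simp [act_apply, h j, Finsupp.single_apply]
  conv_lhs => rw [← b.sum_repr m, map_sum, map_sum, Finsupp.finsetSum_apply]
  refine Finset.sum_congr rfl fun j _ => ?_
  rw [map_smul, map_smul, Finsupp.smul_apply, hb, smul_eq_mul, mul_comm]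

end Action

/-! ### Base change and duals in coordinates -/

section SL2

variable {A M ι : Type*} [CommRing A] [AddCommGroup M] [Module A M] [Fintype ι]

theorem baseChange_coact_one_tmul (B : Type*) [CommRing B] [Algebra A B]
    (ρ : Comod A (SL2Ring A) M) (m : M) :
    (ρ.baseChange B).coact (1 ⊗ₜ m) = extendCoeff A B M (ρ.coact m) := by
  change (extendCoeff A B M ∘ₗ ρ.coact).liftBaseChange B ((1 : B) ⊗ₜ[A] m) = _
  rw [LinearMap.liftBaseChange_tmul, one_smul, LinearMap.comp_apply]

theorem HasMatrix.baseChange {ρ : Comod A (SL2Ring A) M} {b : Module.Basis ι A M}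
    {T : Matrix ι ι (SL2Ring A)} (h : ρ.HasMatrix b T) (B : Type*) [CommRing B] [Algebra A B] :
    (ρ.baseChange B).HasMatrix (b.baseChange B) (T.map (SL2Ring.map A B)) := fun j => by
  simp only [Module.Basis.baseChange_apply, baseChange_coact_one_tmul, h j, map_sum,
    extendCoeff_tmul, Matrix.map_apply]

theorem act_baseChange {B : Type*} [CommRing B] [Algebra A B] (ρ : Comod A (SL2Ring A) M)
    {l : SL2Ring A →ₗ[A] A} {l' : SL2Ring B →ₗ[B] B}
    (hl : ∀ f, l' (SL2Ring.map A B f) = algebraMap A B (l f)) (m : M) :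
    (ρ.baseChange B).act l' (1 ⊗ₜ m) = 1 ⊗ₜ ρ.act l m := by
  rw [act_apply, baseChange_coact_one_tmul, act_apply]
  generalize ρ.coact m = u
  induction u with
  | zero => simp
  | add x y hx hy => simp only [map_add, hx, hy, TensorProduct.tmul_add]
  | tmul m f => simp [extendCoeff_tmul, hl, TensorProduct.tmul_smul]

/-- In the dual basis, the contragredient has the transpose of the antipode of the coefficient
matrix. -/
theorem HasMatrix.dual [DecidableEq ι] [Module.Finite A M] [Module.Projective A M]
    {ρ : Comod A (SL2Ring A) M} {b : Module.Basis ι A M} {T : Matrix ι ι (SL2Ring A)}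
    (h : ρ.HasMatrix b T) :
    ρ.dual.HasMatrix b.dualBasis (T.transpose.map (SL2Ring.antipodeHom A)) := fun j => by
  change dualCoact ρ _ = _
  refine (dualTensorHom_bijective (R := A) (M := M) (N := SL2Ring A)).1 (b.ext fun k => ?_)
  rw [dualTensorHom_dualCoact, dualCoeff_apply, h k]
  simp [Finsupp.single_apply]

end SL2

end Comod

/-! ### Extension of scalars and unipotent subgroups -/

namespace SL2Ring

/-- Extension of scalars is injective on coordinate rings, by flatness of `R_A`. -/
theorem map_injective (A B : Type*) [CommRing A] [CommRing B] [Algebra A B]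
    [Module.Flat A (SL2Ring A)] (h : Function.Injective (algebraMap A B)) :
    Function.Injective (map A B) := by
  let i : SL2Ring A →ₐ[A] B ⊗[A] SL2Ring A := Algebra.TensorProduct.includeRight
  -- The comparison map `R_B → B ⊗ R_A`, a retraction of `map` up to the inclusion of `R_A`.
  let g : SL2Ring B →ₐ[B] B ⊗[A] SL2Ring A := lift ((gen A).map i) (by
    have := AlgHom.map_det i (gen A)
    rw [det_gen, map_one] at this
    exact this.symm)
  have hg : (g.restrictScalars A).comp (map A B) = i := by
    refine algHom_ext fun j k => ?_
    rw [AlgHom.comp_apply, map_x, AlgHom.restrictScalars_apply]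
    exact lift_x _ _ _ _
  refine Function.Injective.of_comp (f := g) ?_
  have hi : Function.Injective i := Algebra.TensorProduct.includeRight_injective h
  rw [← hg] at hi
  exact hi

open Polynomial

/-- The upper unipotent one-parameter subgroup `t ↦ (1, t; 0, 1)`, on coordinate rings. -/
def upper (A : Type*) [CommRing A] : SL2Ring A →ₐ[A] A[X] :=
  lift !![1, X; 0, 1] (by simp [Matrix.det_fin_two])

/-- The lower unipotent one-parameter subgroup `t ↦ (1, 0; t, 1)`, on coordinate rings. -/
def lower (A : Type*) [CommRing A] : SL2Ring A →ₐ[A] A[X] :=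
  lift !![1, 0; X, 1] (by simp [Matrix.det_fin_two])

section

variable (A : Type*) [CommRing A]

theorem upper_x (i j : Fin 2) : upper A (x A i j) = !![1, X; 0, 1] i j := lift_x _ _ i j

theorem lower_x (i j : Fin 2) : lower A (x A i j) = !![1, 0; X, 1] i j := lift_x _ _ i j

theorem upper_map (B : Type*) [CommRing B] [Algebra A B] (f : SL2Ring A) :
    upper B (map A B f) = (upper A f).map (algebraMap A B) := by
  have h : ((upper B).restrictScalars A).comp (map A B)
      = (Polynomial.mapAlgHom (Algebra.ofId A B)).comp (upper A) := by
    refine algHom_ext fun i j => ?_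
    fin_cases i <;> fin_cases j <;> simp [map_x, upper_x]
  exact DFunLike.congr_fun h f

theorem lower_map (B : Type*) [CommRing B] [Algebra A B] (f : SL2Ring A) :
    lower B (map A B f) = (lower A f).map (algebraMap A B) := by
  have h : ((lower B).restrictScalars A).comp (map A B)
      = (Polynomial.mapAlgHom (Algebra.ofId A B)).comp (lower A) := by
    refine algHom_ext fun i j => ?_
    fin_cases i <;> fin_cases j <;> simp [map_x, lower_x]
  exact DFunLike.congr_fun h f

/-- The divided power `E⁽ⁿ⁾` of the upper nilpotent element of the Lie algebra, as a linear form
on the coordinate ring: the coefficient of `tⁿ` on the upper unipotent subgroup. -/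
def divE (n : ℕ) : SL2Ring A →ₗ[A] A := Polynomial.lcoeff A n ∘ₗ (upper A).toLinearMap

/-- The divided power `F⁽ⁿ⁾` of the lower nilpotent element of the Lie algebra, as a linear form
on the coordinate ring: the coefficient of `tⁿ` on the lower unipotent subgroup. -/
def divF (n : ℕ) : SL2Ring A →ₗ[A] A := Polynomial.lcoeff A n ∘ₗ (lower A).toLinearMap

theorem divE_apply (n : ℕ) (f : SL2Ring A) : divE A n f = (upper A f).coeff n := rfl

theorem divF_apply (n : ℕ) (f : SL2Ring A) : divF A n f = (lower A f).coeff n := rfl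

theorem divE_map (n : ℕ) (B : Type*) [CommRing B] [Algebra A B] (f : SL2Ring A) :
    divE B n (map A B f) = algebraMap A B (divE A n f) := by
  rw [divE_apply, upper_map, coeff_map, divE_apply]

theorem divF_map (n : ℕ) (B : Type*) [CommRing B] [Algebra A B] (f : SL2Ring A) :
    divF B n (map A B f) = algebraMap A B (divF A n f) := by
  rw [divF_apply, lower_map, coeff_map, divF_apply]

end

end SL2Ring

/-! ### The symmetric square and the symmetric tensors of the standard comodule -/

namespace SL2Ring

variable (A : Type*) [CommRing A]

/-- The matrix of the symmetric square of the standard comodule in the basis `e₁²`, `e₁ e₂`,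
`e₂²`. -/
def symSqMatrix : Matrix (Fin 3) (Fin 3) (SL2Ring A) :=
  !![x A 0 0 ^ 2, x A 0 0 * x A 0 1, x A 0 1 ^ 2;
    2 * (x A 0 0 * x A 1 0), x A 0 0 * x A 1 1 + x A 0 1 * x A 1 0, 2 * (x A 0 1 * x A 1 1);
    x A 1 0 ^ 2, x A 1 0 * x A 1 1, x A 1 1 ^ 2]

/-- The matrix of the symmetric tensors of the standard comodule in the basis `e₁ ⊗ e₁`,
`e₁ ⊗ e₂ + e₂ ⊗ e₁`, `e₂ ⊗ e₂`. -/
def symTensorsMatrix : Matrix (Fin 3) (Fin 3) (SL2Ring A) :=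
  !![x A 0 0 ^ 2, 2 * (x A 0 0 * x A 0 1), x A 0 1 ^ 2;
    x A 0 0 * x A 1 0, x A 0 0 * x A 1 1 + x A 0 1 * x A 1 0, x A 0 1 * x A 1 1;
    x A 1 0 ^ 2, 2 * (x A 1 0 * x A 1 1), x A 1 1 ^ 2]

theorem symSqMatrix_map (B : Type*) [CommRing B] [Algebra A B] :
    (symSqMatrix A).map (map A B) = symSqMatrix B := by
  ext i j
  fin_cases i <;> fin_cases j <;> simp [symSqMatrix, map_x, map_ofNat]

theorem symTensorsMatrix_map (B : Type*) [CommRing B] [Algebra A B] :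
    (symTensorsMatrix A).map (map A B) = symTensorsMatrix B := by
  ext i j
  fin_cases i <;> fin_cases j <;> simp [symTensorsMatrix, map_x, map_ofNat]

end SL2Ring

namespace Comod

open SL2Ring

variable (A : Type*) [CommRing A]

theorem standard_coact (j : Fin 2) : (standard A).coact (Pi.basisFun A (Fin 2) j)
    = Pi.basisFun A (Fin 2) 0 ⊗ₜ x A 0 j + Pi.basisFun A (Fin 2) 1 ⊗ₜ x A 1 j := by
  refine ((Pi.basisFun A (Fin 2)).constr_basis A _ j).trans ?_
  rw [Fin.sum_univ_two]

theorem standard_tensor_coact (j k : Fin 2) :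
    ((standard A).tensor (standard A)).coact
        (Pi.basisFun A (Fin 2) j ⊗ₜ Pi.basisFun A (Fin 2) k)
      = (Pi.basisFun A (Fin 2) 0 ⊗ₜ Pi.basisFun A (Fin 2) 0) ⊗ₜ (x A 0 j * x A 0 k)
        + (Pi.basisFun A (Fin 2) 0 ⊗ₜ Pi.basisFun A (Fin 2) 1) ⊗ₜ (x A 0 j * x A 1 k)
        + (Pi.basisFun A (Fin 2) 1 ⊗ₜ Pi.basisFun A (Fin 2) 0) ⊗ₜ (x A 1 j * x A 0 k)
        + (Pi.basisFun A (Fin 2) 1 ⊗ₜ Pi.basisFun A (Fin 2) 1) ⊗ₜ (x A 1 j * x A 1 k) := by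
  rw [tensor_coact_tmul, standard_coact, standard_coact]
  simp only [TensorProduct.add_tmul, TensorProduct.tmul_add, map_add, mulCoeff_tmul]
  abel

/-- The basis `e₁²`, `e₁ e₂`, `e₂²` of the symmetric square of `A e₁ ⊕ A e₂`. -/
def symSqBasis : Module.Basis (Fin 3) A (SymSq A (Fin 2 → A)) :=
  Module.Basis.ofEquivFun (symSqEquiv A)

theorem symSqBasis_apply (j : Fin 3) : symSqBasis A j =
    (symRel A (Fin 2 → A)).mkQ (![Pi.basisFun A (Fin 2) 0 ⊗ₜ Pi.basisFun A (Fin 2) 0,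
      Pi.basisFun A (Fin 2) 0 ⊗ₜ Pi.basisFun A (Fin 2) 1,
      Pi.basisFun A (Fin 2) 1 ⊗ₜ Pi.basisFun A (Fin 2) 1] j) := by
  rw [symSqBasis, Module.Basis.coe_ofEquivFun, LinearEquiv.symm_apply_eq]
  change _ = symSqCoord A _
  fin_cases j <;>
  · simp only [Fin.zero_eta, Fin.mk_one, Fin.reduceFinMk, Matrix.cons_val]
    rw [symSqCoord_mk]
    ext i
    fin_cases i <;> simp

theorem symSq_hasMatrix : (standard A).symSq.HasMatrix (symSqBasis A) (symSqMatrix A) := by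
  have h : (symRel A (Fin 2 → A)).mkQ
      (Pi.basisFun A (Fin 2) 1 ⊗ₜ Pi.basisFun A (Fin 2) 0) = (symRel A (Fin 2 → A)).mkQ
      (Pi.basisFun A (Fin 2) 0 ⊗ₜ Pi.basisFun A (Fin 2) 1) :=
    (Submodule.Quotient.eq _).2 (Submodule.subset_span ⟨(_, _), rfl⟩)
  have hc : ∀ t, (standard A).symSq.coact ((symRel A (Fin 2 → A)).mkQ t)
      = (symRel A (Fin 2 → A)).mkQ.rTensor _ (((standard A).tensor (standard A)).coact t) :=
    fun _ => rfl
  intro j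
  rw [symSqBasis_apply, hc, Fin.sum_univ_three]
  simp only [symSqBasis_apply]
  fin_cases j <;>
  · simp only [Fin.zero_eta, Fin.mk_one, Fin.reduceFinMk, Matrix.cons_val]
    rw [standard_tensor_coact]
    simp only [map_add, LinearMap.rTensor_tmul, h, symSqMatrix, Matrix.of_apply,
      Matrix.cons_val, two_mul, TensorProduct.tmul_add, sq, mul_comm (x A 1 1),
      mul_comm (x A 1 0) (x A 0 0), mul_comm (x A 1 0) (x A 0 1)]
    abel

/-- The tensors `e₁ ⊗ e₁`, `e₁ ⊗ e₂ + e₂ ⊗ e₁`, `e₂ ⊗ e₂`. -/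
def symTensorsVec : Fin 3 → (Fin 2 → A) ⊗[A] (Fin 2 → A) :=
  ![Pi.basisFun A (Fin 2) 0 ⊗ₜ Pi.basisFun A (Fin 2) 0,
    Pi.basisFun A (Fin 2) 0 ⊗ₜ Pi.basisFun A (Fin 2) 1
      + Pi.basisFun A (Fin 2) 1 ⊗ₜ Pi.basisFun A (Fin 2) 0,
    Pi.basisFun A (Fin 2) 1 ⊗ₜ Pi.basisFun A (Fin 2) 1]

theorem symTensorsVec_mem (j : Fin 3) : symTensorsVec A j ∈ SymTensors A (Fin 2 → A) := by
  rw [mem_symTensors]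
  fin_cases j <;> simp [symTensorsVec, add_comm]

/-- The basis `eᵢ ⊗ eⱼ` of the tensor square of `A e₁ ⊕ A e₂`. -/
def tensorBasis : Module.Basis (Fin 2 × Fin 2) A ((Fin 2 → A) ⊗[A] (Fin 2 → A)) :=
  (Pi.basisFun A (Fin 2)).tensorProduct (Pi.basisFun A (Fin 2))

theorem tensorBasis_apply (i j : Fin 2) :
    tensorBasis A (i, j) = Pi.basisFun A (Fin 2) i ⊗ₜ Pi.basisFun A (Fin 2) j :=
  Module.Basis.tensorProduct_apply _ _ i j

theorem tensorBasis_repr_tmul (v w : Fin 2 → A) (i j : Fin 2) :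
    (tensorBasis A).repr (v ⊗ₜ w) (i, j) = v i * w j := by
  simp [tensorBasis, mul_comm]

theorem tensorBasis_repr_comm (t : (Fin 2 → A) ⊗[A] (Fin 2 → A)) (i j : Fin 2) :
    (tensorBasis A).repr (TensorProduct.comm A _ _ t) (i, j) = (tensorBasis A).repr t (j, i) := by
  induction t with
  | zero => simp
  | add a b ha hb => simp only [map_add, Finsupp.add_apply, ha, hb]
  | tmul v w => rw [TensorProduct.comm_tmul, tensorBasis_repr_tmul, tensorBasis_repr_tmul, mul_comm]

theorem symTensorsVec_linearIndependent : LinearIndependent A (symTensorsVec A) := by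
  refine Fintype.linearIndependent_iff.2 fun g hg => ?_
  have h : ∀ i j, (tensorBasis A).repr (∑ k, g k • symTensorsVec A k) (i, j) = 0 := fun i j => by
    rw [hg, map_zero, Finsupp.zero_apply]
  simp only [Fin.sum_univ_three, symTensorsVec, Matrix.cons_val, map_add, map_smul,
    Finsupp.add_apply, Finsupp.smul_apply, tensorBasis_repr_tmul] at h
  have h0 := h 0 0
  have h1 := h 0 1
  have h2 := h 1 1
  simp at h0 h1 h2
  intro i
  fin_cases i <;> assumption

theorem eq_sum_symTensorsVec {t : (Fin 2 → A) ⊗[A] (Fin 2 → A)} (ht : t ∈ SymTensors A _) :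
    t = ∑ k, (tensorBasis A).repr t (![(0, 0), (0, 1), (1, 1)] k) • symTensorsVec A k := by
  have h := tensorBasis_repr_comm A t 1 0
  rw [(mem_symTensors t).1 ht] at h
  conv_lhs => rw [← (tensorBasis A).sum_repr t]
  rw [Fintype.sum_prod_type]
  simp only [Fin.sum_univ_two, Fin.sum_univ_three, symTensorsVec, h, Matrix.cons_val,
    tensorBasis_apply, smul_add]
  abel

/-- The basis `e₁ ⊗ e₁`, `e₁ ⊗ e₂ + e₂ ⊗ e₁`, `e₂ ⊗ e₂` of the symmetric tensors of
`A e₁ ⊕ A e₂`. -/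
def symTensorsBasis : Module.Basis (Fin 3) A (SymTensors A (Fin 2 → A)) :=
  Module.Basis.mk (v := fun j => ⟨symTensorsVec A j, symTensorsVec_mem A j⟩)
    (LinearIndependent.of_comp (SymTensors A (Fin 2 → A)).subtype
      (symTensorsVec_linearIndependent A)) (by
    rintro ⟨t, ht⟩ -
    refine (Submodule.mem_span_range_iff_exists_fun A).2
      ⟨fun k => (tensorBasis A).repr t (![(0, 0), (0, 1), (1, 1)] k), Subtype.ext ?_⟩
    rw [Submodule.coe_sum]
    exact (eq_sum_symTensorsVec A ht).symm)

theorem coe_symTensorsBasis (j : Fin 3) :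
    (symTensorsBasis A j : (Fin 2 → A) ⊗[A] (Fin 2 → A)) = symTensorsVec A j := by
  rw [symTensorsBasis, Module.Basis.mk_apply]

theorem symTensors_hasMatrix [Module.Flat A (SL2Ring A)] :
    (standard A).symTensors.HasMatrix (symTensorsBasis A) (symTensorsMatrix A) := by
  intro j
  refine Module.Flat.rTensor_preserves_injective_linearMap (M := SL2Ring A) _
    (SymTensors A (Fin 2 → A)).injective_subtype ?_
  refine (subcomod_coact _ _ _ _).trans ?_
  simp only [Fin.sum_univ_three, map_add, LinearMap.rTensor_tmul, Submodule.subtype_apply,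
    coe_symTensorsBasis, symTensorsVec]
  fin_cases j <;>
  · simp only [Fin.zero_eta, Fin.mk_one, Fin.reduceFinMk, Matrix.cons_val, map_add,
      standard_tensor_coact]
    simp only [symTensorsMatrix, Matrix.of_apply, TensorProduct.add_tmul,
      Matrix.cons_val, two_mul, TensorProduct.tmul_add, sq, mul_comm (x A 1 1),
      mul_comm (x A 0 1) (x A 0 0), mul_comm (x A 1 0) (x A 0 0), mul_comm (x A 1 0) (x A 0 1)]
    abel

/-- The signs `1, -1, 1`, as units. -/
def signs : Fin 3 → Aˣ := ![1, -1, 1]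

section Dual

variable {A} {M : Type*} [AddCommGroup M] [Module A M] [Module.Finite A M] [Module.Projective A M]
  {ρ : Comod A (SL2Ring A) M} {b : Module.Basis (Fin 3) A M}

/-- The antipode reverses `(x_{ij})` along the antidiagonal up to signs, so that the dual of a
comodule with the matrix of `Sym²` has the matrix of `Sym₂`, in the reversed dual basis with
alternating signs. -/
theorem HasMatrix.dual_of_symSqMatrix (h : ρ.HasMatrix b (symSqMatrix A)) :
    ∃ b' : Module.Basis (Fin 3) A (Module.Dual A M), ρ.dual.HasMatrix b' (symTensorsMatrix A) := by
  refine ⟨(b.dualBasis.reindex Fin.revPerm).unitsSMul (signs A),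
    h.dual.monomial Fin.revPerm (fun j => signs A j) (fun j => ?_) fun i j => ?_⟩
  · rw [Module.Basis.unitsSMul_apply, Module.Basis.reindex_apply, Fin.revPerm_symm, Units.smul_def]
  · fin_cases i <;> fin_cases j <;>
    simp [signs, symSqMatrix, symTensorsMatrix, antipodeHom_x00, antipodeHom_x01, antipodeHom_x10,
      antipodeHom_x11, map_ofNat] <;> ring

theorem HasMatrix.dual_of_symTensorsMatrix (h : ρ.HasMatrix b (symTensorsMatrix A)) :
    ∃ b' : Module.Basis (Fin 3) A (Module.Dual A M), ρ.dual.HasMatrix b' (symSqMatrix A) := by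
  refine ⟨(b.dualBasis.reindex Fin.revPerm).unitsSMul (signs A),
    h.dual.monomial Fin.revPerm (fun j => signs A j) (fun j => ?_) fun i j => ?_⟩
  · rw [Module.Basis.unitsSMul_apply, Module.Basis.reindex_apply, Fin.revPerm_symm, Units.smul_def]
  · fin_cases i <;> fin_cases j <;>
    simp [signs, symSqMatrix, symTensorsMatrix, antipodeHom_x00, antipodeHom_x01, antipodeHom_x10,
      antipodeHom_x11, map_ofNat] <;> ring

end Dual

end Comod

/-! ### Lattices stable under divided powers -/

namespace Comod

open SL2Ring

/-- A finitely generated subgroup of `ℚ` is cyclic. -/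
theorem exists_span_singleton_of_fg {N : Submodule ℤ ℚ} (hN : N.FG) :
    ∃ α : ℚ, N = Submodule.span ℤ {α} := by
  let I : FractionalIdeal (nonZeroDivisors ℤ) ℚ := ⟨N, FractionalIdeal.isFractional_of_fg hN⟩
  have hI : (I : Submodule ℤ ℚ).IsPrincipal := inferInstance
  exact hI.principal

/-- A lattice in `ℚ³ = Sym²(ℚ²)` stable under the divided powers `E`, `E⁽²⁾`, `F`, `F⁽²⁾` is, up
to scaling, spanned by `e₁²`, `d e₁ e₂`, `e₂²` with `d = 1` or `d = 2`. -/
theorem exists_weight_basis {W : Type*} [AddCommGroup W] [Module.Finite ℤ W]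
    {φ : W →ₗ[ℤ] Fin 3 → ℚ} (hφ : Function.Injective φ) (h0 : ∃ w, φ w 0 ≠ 0)
    {E E₂ F F₂ : W → W} (hE : ∀ w, φ (E w) = ![φ w 1, 2 * φ w 2, 0])
    (hE₂ : ∀ w, φ (E₂ w) = ![φ w 2, 0, 0]) (hF : ∀ w, φ (F w) = ![0, 2 * φ w 0, φ w 1])
    (hF₂ : ∀ w, φ (F₂ w) = ![0, 0, φ w 0]) :
    ∃ (α : ℚ) (d : ℤ) (b : Module.Basis (Fin 3) ℤ W), (d = 1 ∨ d = 2) ∧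
      φ (b 0) = ![α, 0, 0] ∧ φ (b 1) = ![0, d * α, 0] ∧ φ (b 2) = ![0, 0, α] := by
  obtain ⟨α, hα⟩ := exists_span_singleton_of_fg
    (N := LinearMap.range (LinearMap.proj 0 ∘ₗ φ)) (Module.Finite.iff_fg.1 (Module.Finite.range _))
  have hmem : ∀ w, ∃ n : ℤ, φ w 0 = n * α := fun w => by
    have : φ w 0 ∈ LinearMap.range (LinearMap.proj 0 ∘ₗ φ) := ⟨w, rfl⟩
    rw [hα, Submodule.mem_span_singleton] at this
    obtain ⟨n, hn⟩ := this
    exact ⟨n, by rw [← hn, zsmul_eq_mul]⟩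
  have hα0 : α ≠ 0 := by
    rintro rfl
    obtain ⟨w, hw⟩ := h0
    obtain ⟨n, hn⟩ := hmem w
    exact hw (by rw [hn, mul_zero])
  obtain ⟨u, hu⟩ : α ∈ LinearMap.range (LinearMap.proj 0 ∘ₗ φ) :=
    hα ▸ Submodule.mem_span_singleton_self α
  replace hu : φ u 0 = α := hu
  -- `E⁽²⁾ F⁽²⁾` is the projection to the highest weight space.
  obtain ⟨w₀, hw₀⟩ : ∃ w, φ w = ![α, 0, 0] := ⟨E₂ (F₂ u), by rw [hE₂, hF₂]; simp [hu]⟩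
  obtain ⟨w₂, hw₂⟩ : ∃ w, φ w = ![0, 0, α] := ⟨F₂ u, by rw [hF₂, hu]⟩
  have hv : φ (F w₀) = ![0, 2 * α, 0] := by rw [hF, hw₀]; simp
  -- `E` and `E⁽²⁾` move the other two coordinates to the first one.
  have hmem₁ : ∀ w, ∃ n : ℤ, φ w 1 = n * α := fun w => by
    obtain ⟨n, hn⟩ := hmem (E w)
    exact ⟨n, by rw [← hn, hE]; simp⟩
  have hmem₂ : ∀ w, ∃ n : ℤ, φ w 2 = n * α := fun w => by
    obtain ⟨n, hn⟩ := hmem (E₂ w)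
    exact ⟨n, by rw [← hn, hE₂]; simp⟩
  -- The middle weight space lies between `2αℤ` and `αℤ`.
  obtain ⟨d, w₁, hd, hw₁, hmem₁'⟩ : ∃ (d : ℤ) (w₁ : W), (d = 1 ∨ d = 2) ∧
      φ w₁ = ![0, d * α, 0] ∧ ∀ w, ∃ n : ℤ, φ w 1 = n * (d * α) := by
    by_cases h : ∃ w, ∃ k : ℤ, φ w 1 = (2 * k + 1 : ℤ) * α
    · obtain ⟨w, k, hk⟩ := h
      obtain ⟨m, hm⟩ := hmem w
      obtain ⟨n, hn⟩ := hmem₂ w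
      refine ⟨1, w - m • w₀ - n • w₂ - k • F w₀, Or.inl rfl, ?_, by simpa using hmem₁⟩
      have hw : φ w = ![m * α, (2 * k + 1 : ℤ) * α, n * α] := by
        ext i
        fin_cases i
        exacts [hm, hk, hn]
      simp only [map_sub, map_zsmul, hw, hw₀, hw₂, hv]
      ext i
      fin_cases i <;> simp
      ring
    · refine ⟨2, F w₀, Or.inr rfl, by simpa using hv, fun w => ?_⟩
      obtain ⟨n, hn⟩ := hmem₁ w
      obtain ⟨k, rfl | rfl⟩ := Int.even_or_odd' n
      · exact ⟨k, by rw [hn]; push_cast; ring⟩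
      · exact absurd ⟨w, k, hn⟩ h
  have hd0 : (d : ℚ) ≠ 0 := by rcases hd with rfl | rfl <;> norm_num
  have hsum : ∀ g : Fin 3 → ℤ, φ (∑ i, g i • ![w₀, w₁, w₂] i)
      = ![g 0 * α, g 1 * (d * α), g 2 * α] := fun g => by
    simp only [Fin.sum_univ_three, Matrix.cons_val, map_add, map_zsmul, hw₀, hw₁, hw₂]
    ext i
    fin_cases i <;> simp
  refine ⟨α, d, Module.Basis.mk (v := ![w₀, w₁, w₂])
    (Fintype.linearIndependent_iff.2 fun g hg => ?_) fun w _ =>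
      (Submodule.mem_span_range_iff_exists_fun ℤ).2 ?_, hd, ?_, ?_, ?_⟩
  · have h := hsum g
    rw [hg, map_zero] at h
    have h0 := congrFun h 0
    have h1 := congrFun h 1
    have h2 := congrFun h 2
    simp [hα0, hd0] at h0 h1 h2
    intro i
    fin_cases i <;> assumption
  · obtain ⟨l, hl⟩ := hmem w
    obtain ⟨m, hm⟩ := hmem₁' w
    obtain ⟨n, hn⟩ := hmem₂ w
    refine ⟨![l, m, n], hφ ?_⟩
    rw [hsum]
    ext i
    fin_cases i <;> simp [hl, hm, hn]
  · rw [Module.Basis.mk_apply]; exact hw₀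
  · rw [Module.Basis.mk_apply]; exact hw₁
  · rw [Module.Basis.mk_apply]; exact hw₂

section DividedPowers

variable {A M : Type*} [CommRing A] [AddCommGroup M] [Module A M]
  {ρ : Comod A (SL2Ring A) M} {b : Module.Basis (Fin 3) A M}

theorem HasMatrix.equivFun_act_divE_one (h : ρ.HasMatrix b (symSqMatrix A)) (m : M) :
    b.equivFun (ρ.act (divE A 1) m) = ![b.equivFun m 1, 2 * b.equivFun m 2, 0] := by
  ext i
  rw [Module.Basis.equivFun_apply, h.repr_act, Fin.sum_univ_three]
  fin_cases i <;> simp [symSqMatrix, divE_apply, upper_x, Polynomial.coeff_X_pow, map_ofNat,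
    Polynomial.coeff_ofNat_mul, Polynomial.coeff_one]

theorem HasMatrix.equivFun_act_divE_two (h : ρ.HasMatrix b (symSqMatrix A)) (m : M) :
    b.equivFun (ρ.act (divE A 2) m) = ![b.equivFun m 2, 0, 0] := by
  ext i
  rw [Module.Basis.equivFun_apply, h.repr_act, Fin.sum_univ_three]
  fin_cases i <;> simp [symSqMatrix, divE_apply, upper_x, Polynomial.coeff_X, map_ofNat,
    Polynomial.coeff_ofNat_mul, Polynomial.coeff_one]

theorem HasMatrix.equivFun_act_divF_one (h : ρ.HasMatrix b (symSqMatrix A)) (m : M) :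
    b.equivFun (ρ.act (divF A 1) m) = ![0, 2 * b.equivFun m 0, b.equivFun m 1] := by
  ext i
  rw [Module.Basis.equivFun_apply, h.repr_act, Fin.sum_univ_three]
  fin_cases i <;> simp [symSqMatrix, divF_apply, lower_x, Polynomial.coeff_X_pow, map_ofNat,
    Polynomial.coeff_ofNat_mul, Polynomial.coeff_one]

theorem HasMatrix.equivFun_act_divF_two (h : ρ.HasMatrix b (symSqMatrix A)) (m : M) :
    b.equivFun (ρ.act (divF A 2) m) = ![0, 0, b.equivFun m 0] := by
  ext i
  rw [Module.Basis.equivFun_apply, h.repr_act, Fin.sum_univ_three]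
  fin_cases i <;> simp [symSqMatrix, divF_apply, lower_x, Polynomial.coeff_X, map_ofNat,
    Polynomial.coeff_ofNat_mul, Polynomial.coeff_one]

end DividedPowers

/-- If `2` is invertible, rescaling the middle basis vector turns the matrix of
`Sym₂` into that of `Sym²`. -/
theorem HasMatrix.symSqMatrix_of_symTensorsMatrix {A M : Type*} [CommRing A] [AddCommGroup M]
    [Module A M] [Invertible (2 : A)] {ρ : Comod A (SL2Ring A) M} {b : Module.Basis (Fin 3) A M}
    (h : ρ.HasMatrix b (symTensorsMatrix A)) :
    ∃ b' : Module.Basis (Fin 3) A M, ρ.HasMatrix b' (symSqMatrix A) := by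
  let c : Fin 3 → Aˣ := ![1, (unitOfInvertible 2)⁻¹, 1]
  refine ⟨b.unitsSMul c, h.monomial (Equiv.refl _) (fun j => c j) (fun j => ?_) fun i j => ?_⟩
  · rw [Module.Basis.unitsSMul_apply, Units.smul_def, Equiv.refl_apply]
  · have h2 : algebraMap A (SL2Ring A) (⅟2) * 2 = 1 := by
      rw [← map_ofNat (algebraMap A (SL2Ring A)) 2, ← map_mul, invOf_mul_self, map_one]
    fin_cases i <;> fin_cases j <;>
    simp [c, symSqMatrix, symTensorsMatrix, Algebra.smul_def, ← mul_assoc, h2]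

section Lattice

variable {W : Type*} [AddCommGroup W] (ρ : Comod ℤ (SL2Ring ℤ) W)

/-- The image of `W` in `ℚ ⊗ W ≃ Sym²(ℚ²)` is a lattice stable under the divided powers. In a basis
adapted to the weights its coefficient matrix is known over `ℚ`, and `R_ℤ → R_ℚ` is injective. -/
theorem exists_hasMatrix_of_baseChange_iso [Module.Finite ℤ W] [Module.IsTorsionFree ℤ W]
    (h : (ρ.baseChange ℚ).Iso (standard ℚ).symSq) :
    ∃ b : Module.Basis (Fin 3) ℤ W,
      ρ.HasMatrix b (symSqMatrix ℤ) ∨ ρ.HasMatrix b (symTensorsMatrix ℤ) := by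
  obtain ⟨e, he⟩ := h
  have hQ := symSq_hasMatrix ℚ
  let φ : W →ₗ[ℤ] Fin 3 → ℚ :=
    ((e ≪≫ₗ (symSqBasis ℚ).equivFun).toLinearMap.restrictScalars ℤ) ∘ₗ TensorProduct.mk ℤ ℚ W 1
  have hφ : ∀ w, φ w = (symSqBasis ℚ).equivFun (e (1 ⊗ₜ w)) := fun _ => rfl
  have hinj : Function.Injective φ :=
    (e ≪≫ₗ (symSqBasis ℚ).equivFun).injective.comp (Module.Flat.tensorProduct_mk_injective _ _ _)
  have hact : ∀ {l : SL2Ring ℤ →ₗ[ℤ] ℤ} {l' : SL2Ring ℚ →ₗ[ℚ] ℚ}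
      (_ : ∀ f, l' (SL2Ring.map ℤ ℚ f) = algebraMap ℤ ℚ (l f)) (w : W),
      φ (ρ.act l w) = (symSqBasis ℚ).equivFun ((standard ℚ).symSq.act l' (e (1 ⊗ₜ w))) :=
    fun hl w => by rw [hφ, act_equiv he, act_baseChange ρ hl]
  -- `ℚ ⊗ W` is spanned by the `1 ⊗ w`, so the first coordinate cannot vanish on all of them.
  have hne : ∃ w, φ w 0 ≠ 0 := by
    by_contra! hw
    have hz : (symSqBasis ℚ).coord 0 ∘ₗ e.toLinearMap = 0 := by
      refine TensorProduct.AlgebraTensorModule.curry_injective (LinearMap.ext_ring ?_)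
      exact LinearMap.ext hw
    have := LinearMap.congr_fun hz (e.symm (symSqBasis ℚ 0))
    simp at this
  obtain ⟨α, d, b, hd, h0, h1, h2⟩ := exists_weight_basis hinj hne
    (fun w => (hact (divE_map ℤ 1 ℚ) w).trans (hQ.equivFun_act_divE_one _))
    (fun w => (hact (divE_map ℤ 2 ℚ) w).trans (hQ.equivFun_act_divE_two _))
    (fun w => (hact (divF_map ℤ 1 ℚ) w).trans (hQ.equivFun_act_divF_one _))
    (fun w => (hact (divF_map ℤ 2 ℚ) w).trans (hQ.equivFun_act_divF_two _))
  obtain ⟨T, hT⟩ := HasMatrix.exists_of_basis ρ b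
  have hTQ := (hT.baseChange ℚ).map he
  have hb : ∀ j, (b.baseChange ℚ).map e j = ![α, d * α, α] j • symSqBasis ℚ (Equiv.refl _ j) := by
    intro j
    rw [Module.Basis.map_apply, Module.Basis.baseChange_apply]
    refine (symSqBasis ℚ).equivFun.injective ?_
    rw [← hφ, map_smul, Equiv.refl_apply]
    ext i
    rw [Pi.smul_apply, Module.Basis.equivFun_self]
    fin_cases j
    · refine (congrFun h0 i).trans ?_
      fin_cases i <;> simp
    · refine (congrFun h1 i).trans ?_
      fin_cases i <;> simp
    · refine (congrFun h2 i).trans ?_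
      fin_cases i <;> simp
  -- It suffices to compare coefficient matrices over `ℚ`, in the basis `α e₁²`, `d α e₁ e₂`, `α e₂²`.
  have key : ∀ T' : Matrix (Fin 3) (Fin 3) (SL2Ring ℤ),
      (∀ i j, ![α, d * α, α] j • symSqMatrix ℚ i j
        = ![α, d * α, α] i • T'.map (SL2Ring.map ℤ ℚ) i j) → ρ.HasMatrix b T' := fun T' hT' => by
    have := hTQ.unique (hQ.monomial (Equiv.refl _) _ hb hT')
    rwa [Matrix.map_injective (map_injective ℤ ℚ (algebraMap ℤ ℚ).injective_int) this] at hT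
  refine ⟨b, ?_⟩
  rcases hd with rfl | rfl
  · refine Or.inl (key _ fun i j => ?_)
    rw [symSqMatrix_map]
    fin_cases i <;> fin_cases j <;> simp
  · refine Or.inr (key _ fun i j => ?_)
    rw [symTensorsMatrix_map]
    fin_cases i <;> fin_cases j <;>
    simp [symSqMatrix, symTensorsMatrix, Algebra.smul_def, map_ofNat] <;> ring

theorem HasMatrix.finite_and_isTorsionFree_and_iso {ρ : Comod ℤ (SL2Ring ℤ) W}
    {b : Module.Basis (Fin 3) ℤ W}
    (h : ρ.HasMatrix b (symSqMatrix ℤ) ∨ ρ.HasMatrix b (symTensorsMatrix ℤ)) :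
    Module.Finite ℤ W ∧ Module.IsTorsionFree ℤ W ∧
      (ρ.baseChange ℚ).Iso (standard ℚ).symSq := by
  have : Module.Free ℤ W := Module.Free.of_basis b
  refine ⟨Module.Finite.of_basis b, inferInstance, ?_⟩
  rcases h with h | h
  · have h' := h.baseChange ℚ
    rw [symSqMatrix_map] at h'
    exact h'.iso (symSq_hasMatrix ℚ)
  · have h' := h.baseChange ℚ
    rw [symTensorsMatrix_map] at h'
    have : Invertible (2 : ℚ) := invertibleOfNonzero two_ne_zero
    obtain ⟨b', hb'⟩ := h'.symSqMatrix_of_symTensorsMatrix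
    exact hb'.iso (symSq_hasMatrix ℚ)

end Lattice

end Comod

/-! ### The classification -/

/-- Up to isomorphism, the finitely generated torsion free comodules `W` on `SL₂` over `ℤ` whose
pull back to `ℚ` is isomorphic to `Sym²(ℚ²)` are `Sym²(V)`, `Sym²(V)*`, `Sym₂(V)` and `Sym₂(V)*`,
where `V` is the standard comodule. -/
theorem mainTheorem8 {W : Type*} [AddCommGroup W] (ρ : Comod ℤ (SL2Ring ℤ) W) :
    (Module.Finite ℤ W ∧ Module.IsTorsionFree ℤ W ∧
      (ρ.baseChange ℚ).Iso (Comod.standard ℚ).symSq) ↔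
    (ρ.Iso (Comod.standard ℤ).symSq ∨ ρ.Iso (Comod.standard ℤ).symSq.dual ∨
      ρ.Iso (Comod.standard ℤ).symTensors ∨ ρ.Iso (Comod.standard ℤ).symTensors.dual) := by
  constructor
  · rintro ⟨_, _, h⟩
    obtain ⟨b, hb | hb⟩ := ρ.exists_hasMatrix_of_baseChange_iso h
    · exact Or.inl (hb.iso (Comod.symSq_hasMatrix ℤ))
    · exact Or.inr (Or.inr (Or.inl (hb.iso (Comod.symTensors_hasMatrix ℤ))))
  · rintro (h | h | h | h)
    · obtain ⟨b, hb⟩ := h.exists_hasMatrix (Comod.symSq_hasMatrix ℤ)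
      exact Comod.HasMatrix.finite_and_isTorsionFree_and_iso (Or.inl hb)
    · obtain ⟨b, hb⟩ := (Comod.symSq_hasMatrix ℤ).dual_of_symSqMatrix
      obtain ⟨b', hb'⟩ := h.exists_hasMatrix hb
      exact Comod.HasMatrix.finite_and_isTorsionFree_and_iso (Or.inr hb')
    · obtain ⟨b, hb⟩ := h.exists_hasMatrix (Comod.symTensors_hasMatrix ℤ)
      exact Comod.HasMatrix.finite_and_isTorsionFree_and_iso (Or.inr hb)
    · obtain ⟨b, hb⟩ := (Comod.symTensors_hasMatrix ℤ).dual_of_symTensorsMatrix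
      obtain ⟨b', hb'⟩ := h.exists_hasMatrix hb
      exact Comod.HasMatrix.finite_and_isTorsionFree_and_iso (Or.inl hb')

end
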